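/- All graphs are finite and simple. For a graph $G$, $\alpha(G)$ is its independence number and $\kappa(G)$ its connectivity, i.e. the least number of vertices whose deletion leaves a disconnected graph or a graph with at most one vertex. A 2-factor of $G$ is a spanning subgraph of $G$ in which every vertex has degree $2$. For $n\ge 4$ let $G_1$ be the graph of order $n$ obtained from two disjoint cliques $K_{n-2}$ and $K_2$ by joining two vertices of $K_{n-2}$ to one and the same vertex of $K_2$; let $G_2$ be the graph of order $n$ obtained from disjoint cliques $K_{n-1}$ and $K_1$ by joining one vertex of $K_{n-1}$ to the vertex of $K_1$, where $G_1\subseteq G_2$ are taken on the same vertex set so that the degree-one vertex of $G_1$ is the vertex of $K_1$ and its neighbour in $G_1$ is its neighbour in $G_2$. For $n\ge 3$ let $G_3$ be the graph of order $n$ obtained from disjoint cliques $K_{n-2}$ and $K_2$ by joining one vertex of $K_{n-2}$ to exactly one vertex of $K_2$. Let $\mathcal G$ be the class of all graphs that, for some $n$, are isomorphic to a graph $G$ with $G_1\subseteq G\subseteq G_2$ or to $G_3$. **Theorem 1.5.** Let $G$ be a connected graph of order at least $3\kappa(G)+3$ with $\alpha(G)\le\kappa(G)+1$. Then $G$ has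 a 2-factor with at most two components unless $G\in\mathcal G$, and in that exceptional case it has none; that is, $G$ has a 2-factor with at most two components if and only if $G\notin\mathcal G$. -/

import Mathlib

namespace ChvatalErdos

/-- The connectivity `κ(G)` of a finite graph: the least number of vertices whose deletion
leaves a disconnected graph or a graph with at most one vertex (so `κ(Kₙ) = n - 1`). -/
noncomputable def connectivity {V : Type*} (G : SimpleGraph V) : ℕ :=
  sInf {k : ℕ | ∃ S : Finset V, S.card = k ∧
    (¬ (G.induce ((S : Set V)ᶜ)).Preconnected ∨ ((S : Set V)ᶜ).Subsingleton)}

/-- `F` is a 2-factor of `G`: a spanning subgraph of `G` (a graph on the same vertex set, all of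
whose edges are edges of `G`) in which every vertex has degree 2. -/
def IsTwoFactor {V : Type*} (F G : SimpleGraph V) : Prop :=
  F ≤ G ∧ ∀ v : V, (F.neighborSet v).ncard = 2

/-- The finite graph `G` has a 2-factor with at most `c` components. -/
def HasTwoFactorWithAtMost {V : Type*} (G : SimpleGraph V) (c : ℕ) : Prop :=
  ∃ F : SimpleGraph V, IsTwoFactor F G ∧ Nat.card F.ConnectedComponent ≤ c

/-- The disjoint union of a clique `K_m` and a clique `K₂`, together with the edges that join the
first `j` vertices of `K_m` to one and the same vertex of `K₂`. -/
def cliqueWithK2 (m j : ℕ) : SimpleGraph (Fin m ⊕ Fin 2) :=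
  ((⊤ : SimpleGraph (Fin m)) ⊕g (⊤ : SimpleGraph (Fin 2))) ⊔
    SimpleGraph.fromRel
      (fun a b => ∃ i : Fin m, i.val < j ∧ a = Sum.inl i ∧ b = Sum.inr 0)

/-- The graph `G₁` of order `n = m + 2`: cliques `K_{n-2}` and `K₂`, with two vertices of
`K_{n-2}` joined to a same vertex of `K₂`. -/
def graphG1 (m : ℕ) : SimpleGraph (Fin m ⊕ Fin 2) := cliqueWithK2 m 2

/-- The graph `G₂` of order `n = m + 2`: a clique `K_{n-1}` on all vertices but the last one,
which is joined to exactly one vertex of that clique. -/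
def graphG2 (m : ℕ) : SimpleGraph (Fin m ⊕ Fin 2) :=
  SimpleGraph.fromRel (fun a b => a ≠ Sum.inr 1 ∧ b ≠ Sum.inr 1) ⊔
    SimpleGraph.edge (Sum.inr 0) (Sum.inr 1)

/-- The graph `G₃` of order `n = m + 2`: cliques `K_{n-2}` and `K₂`, with one vertex of
`K_{n-2}` joined to exactly one vertex of `K₂`. -/
def graphG3 (m : ℕ) : SimpleGraph (Fin m ⊕ Fin 2) := cliqueWithK2 m 1

/-- `G` belongs to the exceptional class `𝒢`: up to isomorphism, either `G₁ ⊆ G ⊆ G₂`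
(all three on the same vertex set) or `G` is `G₃`. -/
def IsExceptional {V : Type*} (G : SimpleGraph V) : Prop :=
  (∃ m : ℕ, 2 ≤ m ∧ ∃ e : V ≃ Fin m ⊕ Fin 2,
    graphG1 m ≤ G.map e.toEmbedding ∧ G.map e.toEmbedding ≤ graphG2 m) ∨
  (∃ m : ℕ, 1 ≤ m ∧ Nonempty (G ≃g graphG3 m))

end ChvatalErdos

namespace ChvatalErdos

open Equiv

/-- `l` is a chain of adjacent vertices from `a` to `b`. -/
def IsTrail {V : Type*} (G : SimpleGraph V) (a : V) (l : List V) (b : V) : Prop :=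
  l.IsChain G.Adj ∧ l.head? = some a ∧ l.getLast? = some b

/-- `l` lists the vertices of a cycle of `G` in cyclic order. -/
def IsCyc {V : Type*} (G : SimpleGraph V) (l : List V) : Prop :=
  l.Nodup ∧ 3 ≤ l.length ∧ ∃ a b, IsTrail G a l b ∧ G.Adj b a

section

variable {V : Type*} {G : SimpleGraph V}

namespace IsTrail

theorem singleton (a : V) : IsTrail G a [a] a := by
  simp [IsTrail]

theorem ne_nil {a b : V} {l : List V} (h : IsTrail G a l b) : l ≠ [] := by
  rintro rfl; simp [IsTrail] at h

theorem append {a b c d : V} {l l' : List V} (h : IsTrail G a l b) (hbc : G.Adj b c)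
    (h' : IsTrail G c l' d) : IsTrail G a (l ++ l') d := by
  obtain ⟨h1, h2, h3⟩ := h
  obtain ⟨h1', h2', h3'⟩ := h'
  refine ⟨List.isChain_append.2 ⟨h1, h1', ?_⟩, ?_, ?_⟩
  · simp only [h3, h2', Option.mem_def, Option.some.injEq]
    rintro x rfl y rfl
    exact hbc
  · simp [List.head?_append, h2]
  · simp [List.getLast?_append, h3']

theorem cons {a b c : V} {l : List V} (hab : G.Adj a b) (h : IsTrail G b l c) :
    IsTrail G a (a :: l) c :=
  (singleton a).append hab h

theorem reverse {a b : V} {l : List V} (h : IsTrail G a l b) : IsTrail G b l.reverse a := by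
  obtain ⟨h1, h2, h3⟩ := h
  refine ⟨?_, by simpa using h3, by simpa using h2⟩
  rw [List.isChain_reverse]
  exact h1.imp fun _ _ h => h.symm

theorem of_isChain {l : List V} (h : l.IsChain G.Adj) (hl : l ≠ []) :
    ∃ a b, IsTrail G a l b :=
  ⟨l.head hl, l.getLast hl, h, List.head?_eq_some_head hl, List.getLast?_eq_some_getLast hl⟩

theorem split {a b : V} {l l' : List V} (h : IsTrail G a (l ++ l') b) (hl : l ≠ [])
    (hl' : l' ≠ []) : ∃ c d, IsTrail G a l c ∧ G.Adj c d ∧ IsTrail G d l' b := by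
  obtain ⟨h1, h2, h3⟩ := h
  obtain ⟨hc, hc', hadj⟩ := List.isChain_append.1 h1
  obtain ⟨a1, c, ha⟩ := of_isChain hc hl
  obtain ⟨d, b1, hb⟩ := of_isChain hc' hl'
  have e1 : a1 = a := by
    have := ha.2.1
    rw [List.head?_append, this] at h2
    simpa using h2
  have e2 : b1 = b := by
    have := hb.2.2
    rw [List.getLast?_append, this] at h3
    simpa using h3
  subst e1 e2
  exact ⟨c, d, ha, hadj c (by simp [ha.2.2]) d (by simp [hb.2.1]), hb⟩

theorem head_eq {a b c : V} {l : List V} (h : IsTrail G a (c :: l) b) : a = c := by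
  simpa [eq_comm] using h.2.1

theorem exists_cons {a b : V} {l : List V} (h : IsTrail G a l b) : ∃ l', l = a :: l' := by
  cases l with
  | nil => exact absurd rfl h.ne_nil
  | cons c l => exact ⟨l, by rw [h.head_eq]⟩

theorem exists_concat {a b : V} {l : List V} (h : IsTrail G a l b) : ∃ l', l = l' ++ [b] := by
  obtain ⟨l', hl'⟩ := h.reverse.exists_cons
  exact ⟨l'.reverse, by rw [← List.reverse_reverse l, hl']; simp⟩

theorem left_mem {a b : V} {l : List V} (h : IsTrail G a l b) : a ∈ l := by
  obtain ⟨l', rfl⟩ := h.exists_cons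
  simp

theorem right_mem {a b : V} {l : List V} (h : IsTrail G a l b) : b ∈ l := by
  obtain ⟨l', rfl⟩ := h.exists_concat
  simp

end IsTrail

theorem IsCyc.swap {l l' : List V} (h : IsCyc G (l ++ l')) : IsCyc G (l' ++ l) := by
  by_cases hl : l = []
  · simpa [hl] using h
  by_cases hl' : l' = []
  · simpa [hl'] using h
  obtain ⟨h1, h2, a, b, h3, h4⟩ := h
  obtain ⟨c, d, h5, h6, h7⟩ := h3.split hl hl'
  refine ⟨(List.perm_append_comm.nodup_iff).1 h1, ?_, d, c, h7.append h4 h5, h6⟩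
  simp only [List.length_append] at h2 ⊢
  omega

theorem IsCyc.rotate {l l' : List V} (h : IsCyc G l) (hr : l ~r l') : IsCyc G l' := by
  obtain ⟨n, rfl⟩ := hr
  rw [List.rotate_eq_drop_append_take_mod]
  apply IsCyc.swap
  rwa [List.take_append_drop]

theorem IsCyc.reverse {l : List V} (h : IsCyc G l) : IsCyc G l.reverse := by
  obtain ⟨h1, h2, a, b, h3, h4⟩ := h
  exact ⟨List.nodup_reverse.2 h1, by simpa using h2, b, a, h3.reverse, h4.symm⟩

theorem IsTrail.isCyc {a b : V} {l : List V} (h : IsTrail G a l b) (hab : G.Adj b a)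
    (hn : l.Nodup) (hl : 3 ≤ l.length) : IsCyc G l :=
  ⟨hn, hl, a, b, h, hab⟩

theorem exists_rotated_cons {C : List V} {s : V} (hs : s ∈ C) : ∃ R, C ~r s :: R := by
  obtain ⟨l, l', rfl⟩ := List.append_of_mem hs
  exact ⟨l' ++ l, List.isRotated_append⟩

/-- A cyclic list cut open at two of its members. -/
theorem exists_rotated_pair {C : List V} {s t : V} (hs : s ∈ C) (ht : t ∈ C) (hst : s ≠ t) :
    ∃ X Y, C ~r s :: (X ++ t :: Y) := by
  obtain ⟨R, hR⟩ := exists_rotated_cons hs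
  have : t ∈ s :: R := hR.mem_iff.1 ht
  obtain ⟨X, Y, rfl⟩ := List.append_of_mem ((List.mem_cons.1 this).resolve_left hst.symm)
  exact ⟨X, Y, hR⟩

theorem rotated_pair_swap {C X Y : List V} {s t : V} (h : C ~r s :: (X ++ t :: Y)) :
    C ~r t :: (Y ++ s :: X) :=
  h.trans (List.isRotated_append (l := s :: X) (l' := t :: Y))

variable [DecidableEq V]

theorem formPerm_of_rotated {C l : List V} {a b : V} (hC : C.Nodup) (h : C ~r a :: b :: l) :
    C.formPerm a = b := by
  rw [List.formPerm_eq_of_isRotated hC h]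
  exact List.formPerm_apply_head _ _ _ (h.nodup_iff.1 hC)

theorem formPerm_of_rotated_append {C l l' : List V} {a b : V} (hC : C.Nodup)
    (h : C ~r l ++ a :: b :: l') : C.formPerm a = b := by
  refine formPerm_of_rotated (l := l' ++ l) hC (h.trans ?_)
  exact List.isRotated_append

theorem formPerm_of_rotated_last {C l : List V} {a b : V} (hC : C.Nodup)
    (h : C ~r a :: (l ++ [b])) : C.formPerm b = a := by
  refine formPerm_of_rotated (l := l) hC (h.trans ?_)
  have : (a :: l) ++ [b] ~r [b] ++ (a :: l) := List.isRotated_append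
  simpa using this

theorem IsCyc.adj_formPerm {C : List V} (hC : IsCyc G C) {s : V} (hs : s ∈ C) :
    G.Adj s (C.formPerm s) := by
  obtain ⟨R, hR⟩ := exists_rotated_cons hs
  obtain ⟨h1, h2, a, b, h3, h4⟩ := hC.rotate hR
  match R, h2 with
  | x :: R, _ =>
    rw [formPerm_of_rotated hC.1 hR]
    have := h3.1
    simp only [List.isChain_cons_cons] at this
    exact this.1

theorem formPerm_inv_mem {C : List V} {s : V} (hs : s ∈ C) : C.formPerm⁻¹ s ∈ C :=
  List.mem_of_formPerm_apply_mem (by simpa using hs)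

theorem IsCyc.adj_formPerm_inv {C : List V} (hC : IsCyc G C) {s : V} (hs : s ∈ C) :
    G.Adj (C.formPerm⁻¹ s) s := by
  simpa using hC.adj_formPerm (formPerm_inv_mem hs)

theorem IsCyc.formPerm_formPerm_ne {C : List V} (hC : IsCyc G C) {s : V} (hs : s ∈ C) :
    C.formPerm (C.formPerm s) ≠ s := by
  obtain ⟨R, hR⟩ := exists_rotated_cons hs
  obtain ⟨h1, h2, -⟩ := hC.rotate hR
  match R, h2 with
  | x :: y :: R, _ =>
    rw [formPerm_of_rotated hC.1 hR, formPerm_of_rotated_append (l := [s]) hC.1 hR]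
    rintro rfl
    simp at h1

theorem IsCyc.trail_left {C X Y : List V} {s t : V} (hC : IsCyc G C)
    (h : C ~r s :: (X ++ t :: Y)) (hX : X ≠ []) :
    IsTrail G (C.formPerm s) X (C.formPerm⁻¹ t) := by
  obtain ⟨h1, h2, a, b, h3, h4⟩ := hC.rotate h
  have h3' : IsTrail G a ((s :: X) ++ (t :: Y)) b := h3
  obtain ⟨c, d, h5, -, -⟩ := h3'.split (by simp) (by simp)
  have h5' : IsTrail G a ([s] ++ X) c := h5
  obtain ⟨u, v, -, -, h6⟩ := h5'.split (by simp) hX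
  have e1 : C.formPerm s = v := by
    obtain ⟨X', rfl⟩ := h6.exists_cons
    exact formPerm_of_rotated hC.1 h
  have e2 : C.formPerm⁻¹ t = c := by
    obtain ⟨X', rfl⟩ := h6.exists_concat
    rw [Perm.inv_eq_iff_eq]
    exact (formPerm_of_rotated_append (l := s :: X') (l' := Y) hC.1 (by simpa using h)).symm
  rwa [e1, e2]

theorem IsCyc.trail_right {C X Y : List V} {s t : V} (hC : IsCyc G C)
    (h : C ~r s :: (X ++ t :: Y)) (hY : Y ≠ []) :
    IsTrail G (C.formPerm t) Y (C.formPerm⁻¹ s) :=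
  hC.trail_left (rotated_pair_swap h) hY

theorem rotated_left_ne_nil {C X Y : List V} {s t : V} (hC : C.Nodup)
    (h : C ~r s :: (X ++ t :: Y)) (hst : C.formPerm s ≠ t) : X ≠ [] := by
  rintro rfl
  exact hst (formPerm_of_rotated hC h)

theorem rotated_right_ne_nil {C X Y : List V} {s t : V} (hC : C.Nodup)
    (h : C ~r s :: (X ++ t :: Y)) (hst : C.formPerm t ≠ s) : Y ≠ [] :=
  rotated_left_ne_nil hC (rotated_pair_swap h) hst

theorem hasTwoFactor_of_two_cycles {l m : List V} (hl : IsCyc G l) (hm : m = [] ∨ IsCyc G m)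
    (hlm : l.Disjoint m) (hcov : ∀ v, v ∈ l ∨ v ∈ m) : HasTwoFactorWithAtMost G 2 := by
  classical
  let σ : V → V := fun v => if v ∈ l then l.formPerm v else m.formPerm v
  let τ : V → V := fun v => if v ∈ l then l.formPerm⁻¹ v else m.formPerm⁻¹ v
  have hml : ∀ v, v ∈ m → v ∉ l := fun v h h' => hlm h' h
  have hσl : ∀ v, v ∈ l → σ v = l.formPerm v := fun v hv => if_pos hv
  have hσm : ∀ v, v ∈ m → σ v = m.formPerm v := fun v hv => if_neg (hml v hv)
  have hτl : ∀ v, v ∈ l → τ v = l.formPerm⁻¹ v := fun v hv => if_pos hv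
  have hτm : ∀ v, v ∈ m → τ v = m.formPerm⁻¹ v := fun v hv => if_neg (hml v hv)
  have hmc : ∀ v, v ∈ m → IsCyc G m := by
    rintro v hv
    rcases hm with rfl | hm
    · simp at hv
    · exact hm
  have hστ : ∀ v, σ (τ v) = v := by
    intro v
    rcases hcov v with hv | hv
    · rw [hτl v hv, hσl _ (formPerm_inv_mem hv)]; simp
    · rw [hτm v hv, hσm _ (formPerm_inv_mem hv)]; simp
  have hτσ : ∀ v, τ (σ v) = v := by
    intro v
    rcases hcov v with hv | hv
    · rw [hσl v hv, hτl _ (List.formPerm_apply_mem_of_mem hv)]; simp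
    · rw [hσm v hv, hτm _ (List.formPerm_apply_mem_of_mem hv)]; simp
  have hadj : ∀ v, G.Adj v (σ v) := by
    intro v
    rcases hcov v with hv | hv
    · rw [hσl v hv]; exact hl.adj_formPerm hv
    · rw [hσm v hv]; exact (hmc v hv).adj_formPerm hv
  have hne : ∀ v, σ (σ v) ≠ v := by
    intro v
    rcases hcov v with hv | hv
    · rw [hσl v hv, hσl _ (List.formPerm_apply_mem_of_mem hv)]
      exact hl.formPerm_formPerm_ne hv
    · rw [hσm v hv, hσm _ (List.formPerm_apply_mem_of_mem hv)]
      exact (hmc v hv).formPerm_formPerm_ne hv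
  let F : SimpleGraph V :=
    { Adj := fun x y => σ x = y ∨ σ y = x
      symm := ⟨fun x y h => h.symm⟩
      loopless := ⟨fun x h => (hadj x).ne (h.elim Eq.symm Eq.symm)⟩ }
  have hFσ : ∀ v, F.Adj v (σ v) := fun v => Or.inl rfl
  have hreach : ∀ k : List V, (∀ v ∈ k, σ v = k.formPerm v) → k.Nodup → ∀ a ∈ k, ∀ b ∈ k,
      F.Reachable a b := by
    intro k hk hkn a ha b hb
    have hcyc := hkn.isCycleOn_formPerm
    have hpow : ∀ n : ℕ, (k.formPerm ^ n) a ∈ k ∧ F.Reachable a ((k.formPerm ^ n) a) := by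
      intro n
      induction n with
      | zero => exact ⟨by simpa using ha, by simp⟩
      | succ n ih =>
        rw [pow_succ', Perm.mul_apply]
        refine ⟨List.formPerm_apply_mem_of_mem ih.1, ih.2.trans ?_⟩
        rw [← hk _ ih.1]
        exact (hFσ _).reachable
    have hcyc' : k.formPerm.IsCycleOn (k.toFinset : Set V) := by simpa using hcyc
    obtain ⟨n, -, hn⟩ := hcyc'.exists_pow_eq (by simpa using ha) (by simpa using hb)
    rw [← hn]
    exact (hpow n).2
  refine ⟨F, ⟨?_, ?_⟩, ?_⟩
  · rintro x y (h | h)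
    · rw [← h]; exact hadj x
    · rw [← h]; exact (hadj y).symm
  · intro v
    have : F.neighborSet v = {σ v, τ v} := by
      ext w
      simp only [SimpleGraph.mem_neighborSet, Set.mem_insert_iff, Set.mem_singleton_iff]
      constructor
      · rintro (h | h)
        · exact Or.inl h.symm
        · right; rw [← h, hτσ]
      · rintro (h | h)
        · exact Or.inl h.symm
        · right; rw [h, hστ]
    rw [this, Set.ncard_pair]
    intro h
    apply hne v
    rw [h, hστ]
  · obtain ⟨a, ha⟩ : ∃ a, a ∈ l := List.exists_mem_of_ne_nil l (by
      rintro rfl; have := hl.2.1; simp at this)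
    obtain ⟨b, hb⟩ : ∃ b, ∀ v ∈ m, F.Reachable b v := by
      rcases hm with rfl | hm
      · exact ⟨a, by simp⟩
      · obtain ⟨b, hb⟩ : ∃ b, b ∈ m := List.exists_mem_of_ne_nil m (by
          rintro rfl; have := hm.2.1; simp at this)
        exact ⟨b, fun v hv => hreach m hσm hm.1 b hb v hv⟩
    have hsurj : Function.Surjective
        (fun i : Bool => F.connectedComponentMk (if i then a else b)) := by
      intro c
      induction c using SimpleGraph.ConnectedComponent.ind with
      | h v =>
        rcases hcov v with hv | hv
        · exact ⟨true, SimpleGraph.ConnectedComponent.sound (hreach l hσl hl.1 a ha v hv)⟩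
        · exact ⟨false, SimpleGraph.ConnectedComponent.sound (hb v hv)⟩
    simpa using Nat.card_le_card_of_surjective _ hsurj

end

/-- `C` lists a longest cycle of `G`. -/
def IsLongestCyc {V : Type*} (G : SimpleGraph V) (C : List V) : Prop :=
  IsCyc G C ∧ ∀ l, IsCyc G l → l.length ≤ C.length

/-- `L` lists the inner vertices of a path from `s` to `t` that avoids `C` in between. -/
structure IsHandle {V : Type*} (G : SimpleGraph V) (C : List V) (s t : V) (L : List V) : Prop where
  nodup : L.Nodup
  notMem : ∀ v ∈ L, v ∉ C
  trail : ∃ a b, IsTrail G a L b ∧ G.Adj s a ∧ G.Adj b t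

section

variable {V : Type*} {G : SimpleGraph V}

theorem IsHandle.symm {C L : List V} {s t : V} (h : IsHandle G C s t L) :
    IsHandle G C t s L.reverse := by
  obtain ⟨a, b, h1, h2, h3⟩ := h.trail
  exact ⟨List.nodup_reverse.2 h.nodup, by simpa using h.notMem, b, a, h1.reverse, h3.symm, h2.symm⟩

theorem IsHandle.congr {C C' L : List V} {s t : V} (h : IsHandle G C s t L) (hC : C.Perm C') :
    IsHandle G C' s t L :=
  ⟨h.nodup, fun v hv => by rw [← hC.mem_iff]; exact h.notMem v hv, h.trail⟩

theorem IsHandle.ne_nil {C L : List V} {s t : V} (h : IsHandle G C s t L) : L ≠ [] := by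
  obtain ⟨a, b, h1, -⟩ := h.trail
  exact h1.ne_nil

theorem IsHandle.singleton {C : List V} {s t v : V} (hv : v ∉ C) (hs : G.Adj s v)
    (ht : G.Adj v t) : IsHandle G C s t [v] :=
  ⟨by simp, by simpa using hv, v, v, IsTrail.singleton v, hs, ht⟩

theorem IsLongestCyc.reverse {C : List V} (hC : IsLongestCyc G C) : IsLongestCyc G C.reverse :=
  ⟨hC.1.reverse, by simpa using hC.2⟩

theorem IsLongestCyc.of_perm {C l : List V} (hC : IsLongestCyc G C) (hl : l.Perm C) {a b : V}
    (h : IsTrail G a l b) (hab : G.Adj b a) : IsLongestCyc G l :=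
  ⟨h.isCyc hab (hl.nodup_iff.2 hC.1.1) (by rw [hl.length_eq]; exact hC.1.2.1),
    by rw [hl.length_eq]; exact hC.2⟩

/-- No cycle consists of a longest cycle and further vertices. -/
theorem IsLongestCyc.elim {C D L l : List V} (hC : IsLongestCyc G C) (hD : C ~r D) {a b : V}
    (h : IsTrail G a l b) (hab : G.Adj b a) (hl : l.Perm (D ++ L)) (hL : L ≠ []) (hn : L.Nodup)
    (hLC : ∀ v ∈ L, v ∉ C) : False := by
  have hl' : l.Perm (C ++ L) := hl.trans (hD.perm.symm.append_right L)
  have hn' : (C ++ L).Nodup :=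
    List.Nodup.append hC.1.1 hn (fun v hv hv' => hLC v hv' hv)
  have h1 := hl'.length_eq
  have h2 : 0 < L.length := List.length_pos_of_ne_nil hL
  have h3 := hC.1.2.1
  rw [List.length_append] at h1
  have := hC.2 l (h.isCyc hab (hl'.nodup_iff.2 hn') (by omega))
  omega

variable [DecidableEq V]

theorem IsLongestCyc.formPerm_ne {C L : List V} {s t : V} (hC : IsLongestCyc G C) (hs : s ∈ C)
    (ht : t ∈ C) (hst : s ≠ t) (hL : IsHandle G C s t L) : C.formPerm s ≠ t := by
  intro h
  obtain ⟨X, Y, hr⟩ := exists_rotated_pair hs ht hst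
  obtain ⟨a, b, h1, h2, h3⟩ := hL.trail
  have hX : X = [] := by
    cases X with
    | nil => rfl
    | cons x X =>
      have e := formPerm_of_rotated hC.1.1 hr
      rw [h] at e
      have := hr.nodup_iff.1 hC.1.1
      simp [e] at this
  subst hX
  have hcyc := hC.1.rotate hr
  obtain ⟨-, -, u, v, h4, h5⟩ := hcyc
  have h4' : IsTrail G u ([s] ++ t :: Y) v := h4
  obtain ⟨c, d, h6, h7, h8⟩ := h4'.split (by simp) (by simp)
  cases h6.head_eq
  cases h8.head_eq
  refine hC.elim hr (l := s :: (L ++ t :: Y)) (((h1.append h3 h8)).cons h2) h5 ?_ hL.ne_nil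
    hL.nodup hL.notMem
  refine List.perm_iff_count.2 fun v => ?_
  simp only [List.count_append, List.count_cons, List.nil_append]
  ring

theorem IsLongestCyc.not_adj_formPerm {C L : List V} {s t : V} (hC : IsLongestCyc G C)
    (hs : s ∈ C) (ht : t ∈ C) (hst : s ≠ t) (hL : IsHandle G C s t L) :
    ¬ G.Adj (C.formPerm s) (C.formPerm t) := by
  intro h
  obtain ⟨X, Y, hr⟩ := exists_rotated_pair hs ht hst
  have hX := hC.1.trail_left hr (rotated_left_ne_nil hC.1.1 hr (hC.formPerm_ne hs ht hst hL))
  have hY := hC.1.trail_right hr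
    (rotated_right_ne_nil hC.1.1 hr (hC.formPerm_ne ht hs hst.symm hL.symm))
  obtain ⟨a, b, h1, h2, h3⟩ := hL.trail
  refine hC.elim hr (l := s :: (L ++ t :: (X.reverse ++ Y)))
    ((h1.append h3 ((hX.reverse.append h hY).cons (hC.1.adj_formPerm_inv ht).symm)).cons h2)
    (hC.1.adj_formPerm_inv hs) ?_ hL.ne_nil hL.nodup hL.notMem
  refine List.perm_iff_count.2 fun v => ?_
  simp only [List.count_append, List.count_cons, List.count_reverse]
  ring

theorem IsLongestCyc.not_adj_formPerm_inv {C L : List V} {s t : V} (hC : IsLongestCyc G C)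
    (hs : s ∈ C) (ht : t ∈ C) (hst : s ≠ t) (hL : IsHandle G C s t L) :
    ¬ G.Adj (C.formPerm⁻¹ s) (C.formPerm⁻¹ t) := by
  have := hC.reverse.not_adj_formPerm (by simpa using hs) (by simpa using ht) hst
    (hL.congr (List.reverse_perm C).symm)
  rwa [List.formPerm_reverse] at this

/-- The successors of two ends of a handle have no common neighbour off the cycle and the
handle. -/
theorem IsLongestCyc.not_adj_adj_formPerm {C L : List V} {s t w : V} (hC : IsLongestCyc G C)
    (hs : s ∈ C) (ht : t ∈ C) (hst : s ≠ t) (hL : IsHandle G C s t L) (hw : w ∉ C) (hwL : w ∉ L)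
    (h : G.Adj (C.formPerm s) w) : ¬ G.Adj w (C.formPerm t) := by
  intro h'
  obtain ⟨X, Y, hr⟩ := exists_rotated_pair hs ht hst
  have hX := hC.1.trail_left hr (rotated_left_ne_nil hC.1.1 hr (hC.formPerm_ne hs ht hst hL))
  have hY := hC.1.trail_right hr
    (rotated_right_ne_nil hC.1.1 hr (hC.formPerm_ne ht hs hst.symm hL.symm))
  obtain ⟨a, b, h1, h2, h3⟩ := hL.trail
  refine hC.elim hr (l := s :: (L ++ t :: (X.reverse ++ w :: Y))) (L := w :: L)
    ((h1.append h3 ((hX.reverse.append h (hY.cons h')).cons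
      (hC.1.adj_formPerm_inv ht).symm)).cons h2)
    (hC.1.adj_formPerm_inv hs) ?_ (by simp) (by simpa using ⟨hwL, hL.nodup⟩)
    (by simpa using ⟨hw, hL.notMem⟩)
  refine List.perm_iff_count.2 fun v => ?_
  simp only [List.count_append, List.count_cons, List.count_reverse]
  ring

theorem IsCyc.formPerm_ne_self {C : List V} (hC : IsCyc G C) {s : V} (hs : s ∈ C) :
    C.formPerm s ≠ s := (hC.adj_formPerm hs).ne'

/-- No vertex off a longest cycle is adjacent to two consecutive vertices of it. -/
theorem IsLongestCyc.not_adj_of_adj {C : List V} {s w : V} (hC : IsLongestCyc G C)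
    (hs : s ∈ C) (hw : w ∉ C) (h : G.Adj w s) : ¬ G.Adj w (C.formPerm s) := fun h' =>
  hC.formPerm_ne hs (List.formPerm_apply_mem_of_mem hs) (hC.1.formPerm_ne_self hs).symm
    (IsHandle.singleton hw h.symm h') rfl

/-- If `σ (σ s)` is `t` or adjacent to `σ t`, then the handle can replace `σ s`. -/
theorem IsLongestCyc.exists_reroute {C L : List V} {s t : V} (hC : IsLongestCyc G C)
    (hs : s ∈ C) (ht : t ∈ C) (hst : s ≠ t) (hL : IsHandle G C s t L)
    (h : C.formPerm (C.formPerm s) = t ∨ G.Adj (C.formPerm (C.formPerm s)) (C.formPerm t)) :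
    ∃ D, IsLongestCyc G D ∧ C.formPerm s ∉ D ∧ ∀ v ∈ D, v ∈ C ∨ v ∈ L := by
  obtain ⟨X, Y, hr⟩ := exists_rotated_pair hs ht hst
  have hX := hC.1.trail_left hr (rotated_left_ne_nil hC.1.1 hr (hC.formPerm_ne hs ht hst hL))
  have hY := hC.1.trail_right hr
    (rotated_right_ne_nil hC.1.1 hr (hC.formPerm_ne ht hs hst.symm hL.symm))
  obtain ⟨a, b, h1, h2, h3⟩ := hL.trail
  obtain ⟨X', rfl⟩ := hX.exists_cons
  have key : ∃ e, IsTrail G e (L ++ t :: (X'.reverse ++ Y)) (C.formPerm⁻¹ s) ∧ G.Adj s e := by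
    refine ⟨a, h1.append h3 ?_, h2⟩
    cases X' with
    | nil => simpa using hY.cons (hC.1.adj_formPerm ht)
    | cons x X' =>
      have e1 : C.formPerm (C.formPerm s) = x :=
        formPerm_of_rotated_append (l := [s]) (l' := X' ++ t :: Y) hC.1.1 (by simpa using hr)
      have hxt : x ≠ t := by
        have := hr.nodup_iff.1 hC.1.1
        simp at this
        tauto
      rw [e1] at h
      have hX' : IsTrail G (C.formPerm s) ([C.formPerm s] ++ x :: X') (C.formPerm⁻¹ t) := hX
      obtain ⟨c, d, h5, h6, h7⟩ := hX'.split (by simp) (by simp)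
      cases h7.head_eq
      exact (h7.reverse.append (h.resolve_left hxt) hY).cons (hC.1.adj_formPerm_inv ht).symm
  obtain ⟨e, he, hse⟩ := key
  set D := s :: (L ++ t :: (X'.reverse ++ Y)) with hD
  have hperm : (C.formPerm s :: D).Perm (C ++ L) := by
    refine List.Perm.trans ?_ (hr.perm.symm.append_right L)
    refine List.perm_iff_count.2 fun v => ?_
    simp only [hD, List.count_append, List.count_cons, List.count_reverse]
    ring
  have hn' : (C ++ L).Nodup :=
    List.Nodup.append hC.1.1 hL.nodup (fun v hv hv' => hL.notMem v hv' hv)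
  have hn := hperm.nodup_iff.2 hn'
  rw [List.nodup_cons] at hn
  have hlen := hperm.length_eq
  have hLpos : 0 < L.length := List.length_pos_of_ne_nil hL.ne_nil
  simp only [List.length_cons, List.length_append] at hlen
  have hDlen : C.length ≤ D.length := by omega
  refine ⟨D, ⟨(he.cons hse).isCyc (hC.1.adj_formPerm_inv hs) hn.2 (hC.1.2.1.trans hDlen),
    fun l hl => (hC.2 l hl).trans hDlen⟩, hn.1, fun v hv => ?_⟩
  have : v ∈ C ++ L := hperm.mem_iff.1 (List.mem_cons_of_mem _ hv)
  simpa using this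

end

/-- A longest cycle `C` together with a set `S` of its vertices, any two of which are joined by a
path through all vertices off `C`, in a graph without a 2-factor with at most two components whose
independent sets have at most `|S| + 1` vertices. -/
structure IsFrame {V : Type*} (G : SimpleGraph V) (C : List V) (S : Finset V) : Prop where
  longest : IsLongestCyc G C
  mem : ∀ s ∈ S, s ∈ C
  handle : ∀ s ∈ S, ∀ t ∈ S, s ≠ t → ∃ L, IsHandle G C s t L ∧ ∀ v, v ∉ C → v ∈ L
  base : ∃ h, h ∉ C ∧ ∀ v ∈ C, G.Adj h v → v ∈ S
  indep : ∀ T : Finset V, G.IsIndepSet T → T.card ≤ S.card + 1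
  two_le : 2 ≤ S.card
  lt_length : 3 * S.card < C.length
  noFactor : ¬ HasTwoFactorWithAtMost G 2

section

variable {V : Type*} {G : SimpleGraph V}

namespace IsFrame

theorem congr {C D : List V} {S : Finset V} (hF : IsFrame G C S) (hD : IsLongestCyc G D)
    (h : C.Perm D) : IsFrame G D S := by
  refine ⟨hD, fun s hs => h.mem_iff.1 (hF.mem s hs), fun s hs t ht hst => ?_, ?_, hF.indep,
    hF.two_le, by rw [← h.length_eq]; exact hF.lt_length, hF.noFactor⟩
  · obtain ⟨L, hL, hcov⟩ := hF.handle s hs t ht hst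
    exact ⟨L, hL.congr h, fun v hv => hcov v (by rwa [h.mem_iff])⟩
  · obtain ⟨b, hb, hb'⟩ := hF.base
    exact ⟨b, by rwa [← h.mem_iff], fun v hv => hb' v (h.mem_iff.2 hv)⟩

theorem reverse {C : List V} {S : Finset V} (hF : IsFrame G C S) : IsFrame G C.reverse S :=
  hF.congr hF.longest.reverse (List.reverse_perm C).symm

theorem ne_of_rotated {C X Y : List V} {S : Finset V} {s t : V} (hF : IsFrame G C S)
    (hr : C ~r s :: (X ++ t :: Y)) : s ≠ t := by
  have := hr.nodup_iff.1 hF.longest.1.1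
  rintro rfl
  simp at this

variable [DecidableEq V]

theorem formPerm_notMem {C : List V} {S : Finset V} (hF : IsFrame G C S) {s : V} (hs : s ∈ S) :
    C.formPerm s ∉ S := by
  intro h
  have hne := (hF.longest.1.formPerm_ne_self (hF.mem s hs)).symm
  obtain ⟨L, hL, -⟩ := hF.handle s hs _ h hne
  exact hF.longest.formPerm_ne (hF.mem s hs) (hF.mem _ h) hne hL rfl

theorem formPerm_inv_notMem {C : List V} {S : Finset V} (hF : IsFrame G C S) {s : V}
    (hs : s ∈ S) : C.formPerm⁻¹ s ∉ S := fun h => hF.formPerm_notMem h (by simpa using hs)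

theorem not_adj_succ {C : List V} {S : Finset V} (hF : IsFrame G C S) {s t : V} (hs : s ∈ S)
    (ht : t ∈ S) : ¬ G.Adj (C.formPerm s) (C.formPerm t) := by
  rcases eq_or_ne s t with rfl | hst
  · simp
  obtain ⟨L, hL, -⟩ := hF.handle s hs t ht hst
  exact hF.longest.not_adj_formPerm (hF.mem s hs) (hF.mem t ht) hst hL

theorem not_adj_pred {C : List V} {S : Finset V} (hF : IsFrame G C S) {s t : V} (hs : s ∈ S)
    (ht : t ∈ S) : ¬ G.Adj (C.formPerm⁻¹ s) (C.formPerm⁻¹ t) := by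
  rcases eq_or_ne s t with rfl | hst
  · simp
  obtain ⟨L, hL, -⟩ := hF.handle s hs t ht hst
  exact hF.longest.not_adj_formPerm_inv (hF.mem s hs) (hF.mem t ht) hst hL

theorem trails {C X Y : List V} {S : Finset V} {s t : V} (hF : IsFrame G C S) (hs : s ∈ S)
    (ht : t ∈ S) (hr : C ~r s :: (X ++ t :: Y)) :
    IsTrail G (C.formPerm s) X (C.formPerm⁻¹ t) ∧
      IsTrail G (C.formPerm t) Y (C.formPerm⁻¹ s) := by
  refine ⟨hF.longest.1.trail_left hr (rotated_left_ne_nil hF.longest.1.1 hr ?_),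
    hF.longest.1.trail_right hr (rotated_right_ne_nil hF.longest.1.1 hr ?_)⟩
  · exact fun h => hF.formPerm_notMem hs (h ▸ ht)
  · exact fun h => hF.formPerm_notMem ht (h ▸ hs)

theorem not_adj_succ_pred {C X Y : List V} {S : Finset V} {s t : V} (hF : IsFrame G C S)
    (hs : s ∈ S) (ht : t ∈ S) (hr : C ~r s :: (X ++ t :: Y)) (hX : 3 ≤ X.length) :
    ¬ G.Adj (C.formPerm s) (C.formPerm⁻¹ t) := by
  intro h
  obtain ⟨h1, h2⟩ := hF.trails hs ht hr
  obtain ⟨L, hL, hcov⟩ := hF.handle s hs t ht (hF.ne_of_rotated hr)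
  obtain ⟨a, b, h3, h4, h5⟩ := hL.trail
  have hC := hF.longest.1
  have hn' : (C ++ L).Nodup :=
    List.Nodup.append hC.1 hL.nodup (fun v hv hv' => hL.notMem v hv' hv)
  have hperm : (X ++ (s :: (L ++ t :: Y))).Perm (C ++ L) := by
    refine List.Perm.trans ?_ (hr.perm.symm.append_right L)
    refine List.perm_iff_count.2 fun v => ?_
    simp only [List.count_append, List.count_cons]
    ring
  have hn := hperm.nodup_iff.2 hn'
  rw [List.nodup_append'] at hn
  refine hF.noFactor (hasTwoFactor_of_two_cycles (h1.isCyc h.symm hn.1 hX)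
    (Or.inr (((h3.append h5 (h2.cons (hC.adj_formPerm (hF.mem t ht)))).cons h4).isCyc
      (hC.adj_formPerm_inv (hF.mem s hs)) hn.2.1 ?_)) hn.2.2 fun v => ?_)
  · have := List.length_pos_of_ne_nil hL.ne_nil
    simp only [List.length_cons, List.length_append]
    omega
  · have : v ∈ C ++ L := by
      by_cases hv : v ∈ C
      · simp [hv]
      · simp [hcov v hv]
    rw [← List.mem_append]
    exact hperm.mem_iff.2 this

theorem exists_three_notMem {C : List V} {S : Finset V} (hF : IsFrame G C S) :
    ∃ x ∈ C, x ∉ S ∧ C.formPerm x ∉ S ∧ C.formPerm (C.formPerm x) ∉ S := by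
  by_contra! hcon
  have hsub : C.toFinset ⊆
      S ∪ (S.image ⇑(C.formPerm⁻¹) ∪ S.image (fun x => C.formPerm⁻¹ (C.formPerm⁻¹ x))) := by
    intro x hx
    have := hcon x (by simpa using hx)
    simp only [Finset.mem_union, Finset.mem_image]
    by_cases h1 : x ∈ S
    · exact Or.inl h1
    by_cases h2 : C.formPerm x ∈ S
    · exact Or.inr (Or.inl ⟨_, h2, by simp⟩)
    · exact Or.inr (Or.inr ⟨_, this h1 h2, by simp⟩)
  have h1 := Finset.card_le_card hsub
  rw [List.toFinset_card_of_nodup hF.longest.1.1] at h1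
  have h2 := Finset.card_union_le S
    (S.image ⇑(C.formPerm⁻¹) ∪ S.image (fun x => C.formPerm⁻¹ (C.formPerm⁻¹ x)))
  have h3 := Finset.card_union_le (S.image ⇑(C.formPerm⁻¹))
    (S.image (fun x => C.formPerm⁻¹ (C.formPerm⁻¹ x)))
  have h4 := Finset.card_image_le (s := S) (f := ⇑(C.formPerm⁻¹))
  have h5 := Finset.card_image_le (s := S) (f := fun x => C.formPerm⁻¹ (C.formPerm⁻¹ x))
  have := hF.lt_length
  omega

theorem exists_rotated_three {C : List V} {S : Finset V} (hF : IsFrame G C S) {s : V}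
    (hs : s ∈ S) : ∃ A x y z B, C ~r s :: (A ++ x :: y :: z :: B) ∧ x ∉ S ∧ y ∉ S ∧ z ∉ S := by
  obtain ⟨x, hxC, hx, hy, hz⟩ := hF.exists_three_notMem
  have hC := hF.longest.1.1
  obtain ⟨A, R, hr⟩ := exists_rotated_pair (hF.mem s hs) hxC (fun h => hx (h ▸ hs))
  cases R with
  | nil => exact absurd (formPerm_of_rotated_last hC hr ▸ hs) hy
  | cons y R =>
    have e1 : C.formPerm x = y :=
      formPerm_of_rotated_append (l := s :: A) (l' := R) hC (by simpa using hr)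
    rw [e1] at hy hz
    cases R with
    | nil =>
      have e2 : C.formPerm y = s :=
        formPerm_of_rotated_last (l := A ++ [x]) hC (by simpa using hr)
      exact absurd (e2 ▸ hs) hz
    | cons z B =>
      have e2 : C.formPerm y = z :=
        formPerm_of_rotated_append (l := s :: (A ++ [x])) (l' := B) hC (by simpa using hr)
      rw [e2] at hz
      exact ⟨A, x, y, z, B, hr, hx, hy, hz⟩

theorem adj_pred_succ {C : List V} {S : Finset V} (hF : IsFrame G C S) {s : V} (hs : s ∈ S) :
    G.Adj (C.formPerm⁻¹ s) (C.formPerm s) := by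
  by_contra hnot
  obtain ⟨A, x, y, z, B, hr, hx, hy, hz⟩ := hF.exists_rotated_three hs
  have hC := hF.longest.1
  have hnd := hr.nodup_iff.1 hC.1
  obtain ⟨h, hhC, hh⟩ := hF.base
  set T₁ := S.filter (· ∈ s :: A) with hT₁
  set T₂ := S.filter (· ∈ s :: B) with hT₂
  have harc : ∀ t ∈ T₁, ∀ r ∈ T₂, t ≠ r → ∃ X Y, C ~r t :: (X ++ r :: Y) ∧ 3 ≤ X.length := by
    intro t ht r hr' htr
    simp only [hT₁, hT₂, Finset.mem_filter, List.mem_cons] at ht hr'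
    rcases ht.2 with rfl | htA
    · obtain ⟨B1, B2, rfl⟩ := List.append_of_mem (hr'.2.resolve_left htr.symm)
      exact ⟨A ++ x :: y :: z :: B1, B2, by simpa using hr, by simp; omega⟩
    · obtain ⟨A1, A2, rfl⟩ := List.append_of_mem htA
      rcases hr'.2 with rfl | hrB
      · exact ⟨A2 ++ x :: y :: z :: B, A1,
          rotated_pair_swap (X := A1) (by simpa using hr), by simp; omega⟩
      · obtain ⟨B1, B2, rfl⟩ := List.append_of_mem hrB
        refine ⟨A2 ++ x :: y :: z :: B1, B2 ++ s :: A1, ?_, by simp; omega⟩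
        have := rotated_pair_swap (C := C) (s := s) (t := t) (X := A1)
          (Y := A2 ++ x :: y :: z :: (B1 ++ r :: B2)) (by simpa using hr)
        simpa using this
  have hnadj : ∀ t ∈ T₁, ∀ r ∈ T₂, ¬ G.Adj (C.formPerm t) (C.formPerm⁻¹ r) := by
    intro t ht r hr' hadj
    have ht' := (Finset.mem_filter.1 ht)
    have hr'' := (Finset.mem_filter.1 hr')
    rcases eq_or_ne t r with rfl | htr
    · have hAB : t = s := by
        by_contra hts
        have h1 : t ∈ A := (List.mem_cons.1 ht'.2).resolve_left hts
        have h2 : t ∈ B := (List.mem_cons.1 hr''.2).resolve_left hts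
        rw [List.nodup_cons, List.nodup_append'] at hnd
        exact hnd.2.2.2 h1 (by simp [h2])
      subst hAB
      exact hnot hadj.symm
    · obtain ⟨X, Y, hXY, hX⟩ := harc t ht r hr' htr
      exact hF.not_adj_succ_pred ht'.1 hr''.1 hXY hX hadj
  have hne : ∀ t ∈ T₁, ∀ r ∈ T₂, C.formPerm t ≠ C.formPerm⁻¹ r := by
    intro t ht r hr' heq
    have heq' : C.formPerm (C.formPerm t) = r := by rw [heq]; simp
    rcases eq_or_ne t r with rfl | htr
    · exact hC.formPerm_formPerm_ne (hF.mem _ (Finset.mem_filter.1 ht).1) heq'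
    · obtain ⟨X, Y, hXY, hX⟩ := harc t ht r hr' htr
      match X, hX with
      | a :: b :: X, _ =>
        have e1 : C.formPerm t = a := formPerm_of_rotated hC.1 hXY
        have e2 : C.formPerm a = b :=
          formPerm_of_rotated_append (l := [t]) hC.1 (by simpa using hXY)
        rw [e1, e2] at heq'
        have := hXY.nodup_iff.1 hC.1
        simp [heq'] at this
  have hunion : T₁ ∪ T₂ = S := by
    ext v
    simp only [hT₁, hT₂, Finset.mem_union, Finset.mem_filter]
    constructor
    · rintro (h | h) <;> exact h.1
    · intro hv
      have := hr.mem_iff.1 (hF.mem v hv)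
      simp only [List.mem_cons, List.mem_append] at this ⊢
      have h1 : v ≠ x := fun h => hx (h ▸ hv)
      have h2 : v ≠ y := fun h => hy (h ▸ hv)
      have h3 : v ≠ z := fun h => hz (h ▸ hv)
      tauto
  have hinter : s ∈ T₁ ∩ T₂ := by simp [hT₁, hT₂, hs]
  have hcard := Finset.card_union_add_card_inter T₁ T₂
  rw [hunion] at hcard
  have hpos : 0 < (T₁ ∩ T₂).card := Finset.card_pos.2 ⟨s, hinter⟩
  set T := T₁.image C.formPerm ∪ T₂.image ⇑(C.formPerm⁻¹) with hT
  have hTcard : T.card = T₁.card + T₂.card := by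
    rw [hT, Finset.card_union_of_disjoint, Finset.card_image_of_injective _ C.formPerm.injective,
      Finset.card_image_of_injective _ (C.formPerm⁻¹).injective]
    rw [Finset.disjoint_left]
    intro v h1 h2
    obtain ⟨t, ht, rfl⟩ := Finset.mem_image.1 h1
    obtain ⟨r, hr', he⟩ := Finset.mem_image.1 h2
    exact hne t ht r hr' he.symm
  have hTC : ∀ v ∈ T, v ∈ C ∧ v ∉ S := by
    intro v hv
    rcases Finset.mem_union.1 hv with hv | hv <;> obtain ⟨t, ht, rfl⟩ := Finset.mem_image.1 hv
    · have := (Finset.mem_filter.1 ht).1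
      exact ⟨List.formPerm_apply_mem_of_mem (hF.mem _ this), hF.formPerm_notMem this⟩
    · have := (Finset.mem_filter.1 ht).1
      exact ⟨formPerm_inv_mem (hF.mem _ this), hF.formPerm_inv_notMem this⟩
  have hhT : h ∉ T := fun hm => hhC (hTC h hm).1
  have hhadj : ∀ v ∈ T, ¬ G.Adj h v := fun v hv hadj => (hTC v hv).2 (hh v (hTC v hv).1 hadj)
  have hTadj : ∀ u ∈ T, ∀ v ∈ T, ¬ G.Adj u v := by
    intro u hu v hv
    rcases Finset.mem_union.1 hu with hu | hu <;> obtain ⟨t, ht, rfl⟩ := Finset.mem_image.1 hu <;>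
    rcases Finset.mem_union.1 hv with hv | hv <;> obtain ⟨r, hr', rfl⟩ := Finset.mem_image.1 hv
    · exact hF.not_adj_succ (Finset.mem_filter.1 ht).1 (Finset.mem_filter.1 hr').1
    · exact hnadj t ht r hr'
    · exact fun hadj => hnadj r hr' t ht hadj.symm
    · exact hF.not_adj_pred (Finset.mem_filter.1 ht).1 (Finset.mem_filter.1 hr').1
  have hind : G.IsIndepSet (insert h T : Finset V) := by
    rintro u hu v hv -
    simp only [Finset.coe_insert, Set.mem_insert_iff, Finset.mem_coe] at hu hv
    rcases hu with rfl | hu <;> rcases hv with rfl | hv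
    · simp
    · exact hhadj v hv
    · exact fun hadj => hhadj u hu hadj.symm
    · exact hTadj u hu v hv
  have := hF.indep _ hind
  rw [Finset.card_insert_of_notMem hhT] at this
  omega

theorem not_adj {C : List V} {S : Finset V} (hF : IsFrame G C S) {s t : V} (hs : s ∈ S)
    (ht : t ∈ S) : ¬ G.Adj s t := by
  intro h
  obtain ⟨X, Y, hr⟩ := exists_rotated_pair (hF.mem s hs) (hF.mem t ht) h.ne
  obtain ⟨h1, h2⟩ := hF.trails hs ht hr
  obtain ⟨L, hL, hcov⟩ := hF.handle s hs t ht h.ne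
  obtain ⟨a, b, h3, h4, h5⟩ := hL.trail
  have hC := hF.longest.1
  have hn' : (C ++ L).Nodup :=
    List.Nodup.append hC.1 hL.nodup (fun v hv hv' => hL.notMem v hv' hv)
  have hperm : ((X ++ Y) ++ (s :: (L ++ [t]))).Perm (C ++ L) := by
    refine List.Perm.trans ?_ (hr.perm.symm.append_right L)
    refine List.perm_iff_count.2 fun v => ?_
    simp only [List.count_append, List.count_cons, List.count_nil]
    ring
  have hn := hperm.nodup_iff.2 hn'
  rw [List.nodup_append'] at hn
  refine hF.noFactor (hasTwoFactor_of_two_cycles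
    ((h1.append (hF.adj_pred_succ ht) h2).isCyc (hF.adj_pred_succ hs) hn.1 ?_)
    (Or.inr (((h3.append h5 (IsTrail.singleton t)).cons h4).isCyc h.symm hn.2.1 ?_)) hn.2.2
    fun v => ?_)
  · have h6 := hr.perm.length_eq
    have h7 := hF.lt_length
    have h8 := hF.two_le
    simp only [List.length_cons, List.length_append] at h6 ⊢
    omega
  · have := List.length_pos_of_ne_nil hL.ne_nil
    simp only [List.length_cons, List.length_append, List.length_nil]
    omega
  · have : v ∈ C ++ L := by
      by_cases hv : v ∈ C
      · simp [hv]
      · simp [hcov v hv]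
    rw [← List.mem_append]
    exact hperm.mem_iff.2 this

theorem not_adj_succ_of_ne {C : List V} {S : Finset V} (hF : IsFrame G C S) {s t : V}
    (hs : s ∈ S) (ht : t ∈ S) (hst : s ≠ t) : ¬ G.Adj s (C.formPerm t) := by
  intro h
  obtain ⟨X, Y, hr⟩ := exists_rotated_pair (hF.mem s hs) (hF.mem t ht) hst
  obtain ⟨h1, h2⟩ := hF.trails hs ht hr
  obtain ⟨L, hL, -⟩ := hF.handle t ht s hs hst.symm
  obtain ⟨a, b, h3, h4, h5⟩ := hL.trail
  refine hF.longest.elim hr (l := X ++ t :: (L ++ s :: Y))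
    (h1.append (hF.longest.1.adj_formPerm_inv (hF.mem t ht))
      ((h3.append h5 (h2.cons h)).cons h4)) (hF.adj_pred_succ hs) ?_ hL.ne_nil hL.nodup hL.notMem
  refine List.perm_iff_count.2 fun v => ?_
  simp only [List.count_append, List.count_cons]
  ring

theorem not_adj_pred_of_ne {C : List V} {S : Finset V} (hF : IsFrame G C S) {s t : V}
    (hs : s ∈ S) (ht : t ∈ S) (hst : s ≠ t) : ¬ G.Adj s (C.formPerm⁻¹ t) := by
  have := hF.reverse.not_adj_succ_of_ne hs ht hst
  rwa [List.formPerm_reverse] at this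

theorem exists_concat {C X Y : List V} {S : Finset V} {s t : V} (hF : IsFrame G C S)
    (hs : s ∈ S) (ht : t ∈ S) (hr : C ~r s :: (X ++ t :: Y)) :
    ∃ X', X = X' ++ [C.formPerm⁻¹ t] ∧
      IsTrail G (C.formPerm s) X' (C.formPerm⁻¹ (C.formPerm⁻¹ t)) := by
  obtain ⟨h1, h2⟩ := hF.trails hs ht hr
  obtain ⟨X', rfl⟩ := h1.exists_concat
  refine ⟨X', rfl, ?_⟩
  refine hF.longest.1.trail_left (Y := t :: Y) (by simpa using hr) ?_
  rintro rfl
  have := h1.head_eq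
  have h3 := hF.adj_pred_succ ht
  rw [← this] at h3
  exact hF.not_adj_succ hs ht h3

theorem not_adj_predpred_pred {C : List V} {S : Finset V} (hF : IsFrame G C S) {s t : V}
    (hs : s ∈ S) (ht : t ∈ S) (hst : s ≠ t) :
    ¬ G.Adj (C.formPerm⁻¹ (C.formPerm⁻¹ t)) (C.formPerm⁻¹ s) := by
  intro h
  obtain ⟨X, Y, hr⟩ := exists_rotated_pair (hF.mem s hs) (hF.mem t ht) hst
  obtain ⟨-, h2⟩ := hF.trails hs ht hr
  obtain ⟨X, rfl, h1⟩ := hF.exists_concat hs ht hr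
  obtain ⟨L, hL, -⟩ := hF.handle t ht s hs hst.symm
  obtain ⟨a, b, h3, h4, h5⟩ := hL.trail
  refine hF.longest.elim hr (l := s :: (X ++ (Y.reverse ++ C.formPerm⁻¹ t :: t :: L)))
    ((h1.append h (h2.reverse.append (hF.adj_pred_succ ht).symm
      ((h3.cons h4).cons (hF.longest.1.adj_formPerm_inv (hF.mem t ht))))).cons
        (hF.longest.1.adj_formPerm (hF.mem s hs))) h5 ?_ hL.ne_nil hL.nodup hL.notMem
  refine List.perm_iff_count.2 fun v => ?_
  simp only [List.count_append, List.count_cons, List.count_reverse, List.count_nil]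
  ring

theorem not_adj_predpred {C : List V} {S : Finset V} (hF : IsFrame G C S) {s t : V}
    (hs : s ∈ S) (ht : t ∈ S) (hst : s ≠ t) :
    ¬ G.Adj (C.formPerm⁻¹ (C.formPerm⁻¹ t)) (C.formPerm⁻¹ (C.formPerm⁻¹ s)) := by
  intro h
  obtain ⟨X, Y, hr⟩ := exists_rotated_pair (hF.mem s hs) (hF.mem t ht) hst
  obtain ⟨X, rfl, h1⟩ := hF.exists_concat hs ht hr
  obtain ⟨Y, rfl, h2⟩ := hF.exists_concat ht hs (rotated_pair_swap hr)
  obtain ⟨L, hL, -⟩ := hF.handle s hs t ht hst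
  obtain ⟨a, b, h3, h4, h5⟩ := hL.trail
  refine hF.longest.elim hr
    (l := t :: C.formPerm⁻¹ t :: (Y ++ (X.reverse ++ C.formPerm⁻¹ s :: s :: L)))
    (((h2.append h.symm (h1.reverse.append (hF.adj_pred_succ hs).symm ((h3.cons h4).cons
      (hF.longest.1.adj_formPerm_inv (hF.mem s hs))))).cons (hF.adj_pred_succ ht)).cons
        (hF.longest.1.adj_formPerm_inv (hF.mem t ht)).symm) h5 ?_ hL.ne_nil hL.nodup hL.notMem
  refine List.perm_iff_count.2 fun v => ?_
  simp only [List.count_append, List.count_cons, List.count_reverse, List.count_nil]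
  ring

theorem not_adj_predpred_of_ne {C : List V} {S : Finset V} (hF : IsFrame G C S) {s t : V}
    (hs : s ∈ S) (ht : t ∈ S) (hst : s ≠ t) :
    ¬ G.Adj s (C.formPerm⁻¹ (C.formPerm⁻¹ t)) := by
  intro h
  obtain ⟨X, Y, hr⟩ := exists_rotated_pair (hF.mem s hs) (hF.mem t ht) hst
  obtain ⟨-, h2⟩ := hF.trails hs ht hr
  obtain ⟨X, rfl, h1⟩ := hF.exists_concat hs ht hr
  obtain ⟨L, hL, -⟩ := hF.handle s hs t ht hst
  obtain ⟨a, b, h3, h4, h5⟩ := hL.trail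
  refine hF.longest.elim hr (l := X ++ s :: (L ++ t :: C.formPerm⁻¹ t :: Y))
    (h1.append h.symm ((h3.append h5 ((h2.cons (hF.adj_pred_succ ht)).cons
      (hF.longest.1.adj_formPerm_inv (hF.mem t ht)).symm)).cons h4))
    (hF.adj_pred_succ hs) ?_ hL.ne_nil hL.nodup hL.notMem
  refine List.perm_iff_count.2 fun v => ?_
  simp only [List.count_append, List.count_cons, List.count_nil]
  ring

/-- If `t` is adjacent to its second predecessor, it can be moved one place back on the cycle. -/
theorem shift {C X Y : List V} {S : Finset V} {s t w : V} (hF : IsFrame G C S)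
    (hs : s ∈ S) (ht : t ∈ S) (hr : C ~r s :: (X ++ w :: t :: Y))
    (h : G.Adj t (C.formPerm⁻¹ (C.formPerm⁻¹ t))) : IsFrame G (s :: (X ++ t :: w :: Y)) S := by
  have hr' : C ~r s :: ((X ++ [w]) ++ t :: Y) := by simpa using hr
  obtain ⟨-, h2⟩ := hF.trails hs ht hr'
  obtain ⟨X', h0, h1⟩ := hF.exists_concat hs ht hr'
  obtain ⟨rfl, h0'⟩ := List.append_inj' h0 rfl
  obtain rfl : w = C.formPerm⁻¹ t := by simpa using h0'
  have hperm : C.Perm (s :: (X ++ t :: C.formPerm⁻¹ t :: Y)) := by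
    refine hr.perm.trans (List.perm_iff_count.2 fun v => ?_)
    simp only [List.count_append, List.count_cons]
    ring
  exact hF.congr (hF.longest.of_perm hperm.symm ((h1.append h.symm ((h2.cons
    (hF.adj_pred_succ ht)).cons (hF.longest.1.adj_formPerm_inv (hF.mem t ht)).symm)).cons
      (hF.longest.1.adj_formPerm (hF.mem s hs))) (hF.longest.1.adj_formPerm_inv (hF.mem s hs)))
    hperm

theorem formPerm_inv_eq {C X Y : List V} {s t w z : V} (hC : C.Nodup)
    (hr : C ~r s :: (X ++ z :: w :: t :: Y)) :
    C.formPerm⁻¹ t = w ∧ C.formPerm⁻¹ (C.formPerm⁻¹ t) = z := by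
  have e1 : C.formPerm w = t :=
    formPerm_of_rotated_append (l := s :: (X ++ [z])) (l' := Y) hC (by simpa using hr)
  have e2 : C.formPerm z = w :=
    formPerm_of_rotated_append (l := s :: X) (l' := t :: Y) hC (by simpa using hr)
  have e3 : C.formPerm⁻¹ t = w := by rw [Perm.inv_eq_iff_eq, e1]
  refine ⟨e3, ?_⟩
  rw [e3, Perm.inv_eq_iff_eq, e2]

theorem exists_rotated_concat {C X Y : List V} {S : Finset V} {s t : V} (hF : IsFrame G C S)
    (hs : s ∈ S) (ht : t ∈ S) (hr : C ~r s :: (X ++ t :: Y)) : ∃ X' z w, X = X' ++ [z, w] := by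
  obtain ⟨X', rfl, h1⟩ := hF.exists_concat hs ht hr
  obtain ⟨X'', rfl⟩ := h1.exists_concat
  exact ⟨X'', _, _, List.append_assoc _ _ _⟩

theorem exists_shifted_right {S : Finset V} {p q : V} (hp : p ∈ S) (hq : q ∈ S) (n : ℕ) :
    ∀ {C X Y : List V}, IsFrame G C S → C ~r p :: (X ++ q :: Y) → X.length = n →
    ∃ D X' z w Y', IsFrame G D S ∧ D ~r p :: (X' ++ z :: w :: q :: Y') ∧ ¬ G.Adj q z := by
  induction n with
  | zero =>
    intro C X Y hF hr hX
    exact absurd (List.length_eq_zero_iff.1 hX) (hF.trails hp hq hr).1.ne_nil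
  | succ n ih =>
    intro C X Y hF hr hX
    obtain ⟨X', z, w, rfl⟩ := hF.exists_rotated_concat hp hq hr
    have hr' : C ~r p :: (X' ++ z :: w :: q :: Y) := by simpa using hr
    by_cases hqz : G.Adj q z
    · have := hF.shift (X := X' ++ [z]) hp hq (by simpa using hr)
        (by rwa [(formPerm_inv_eq hF.longest.1.1 hr').2])
      exact ih this (List.IsRotated.refl _) (by simpa using hX)
    · exact ⟨C, X', z, w, Y, hF, hr', hqz⟩

theorem exists_shifted_both {S : Finset V} {p q : V} (hp : p ∈ S) (hq : q ∈ S) (n : ℕ) :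
    ∀ {C X Y : List V} {z w : V}, IsFrame G C S → C ~r p :: (X ++ z :: w :: q :: Y) →
    ¬ G.Adj q z → Y.length = n →
    ∃ D, IsFrame G D S ∧ ¬ G.Adj p (D.formPerm⁻¹ (D.formPerm⁻¹ p)) ∧
      ¬ G.Adj q (D.formPerm⁻¹ (D.formPerm⁻¹ q)) := by
  induction n with
  | zero =>
    intro C X Y z w hF hr hqz hY
    have hr' : C ~r p :: ((X ++ [z, w]) ++ q :: Y) := by simpa using hr
    exact absurd (List.length_eq_zero_iff.1 hY) (hF.trails hp hq hr').2.ne_nil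
  | succ n ih =>
    intro C X Y z w hF hr hqz hY
    have hr' : C ~r p :: ((X ++ [z, w]) ++ q :: Y) := by simpa using hr
    have hr'' := rotated_pair_swap hr'
    obtain ⟨Y', z', w', rfl⟩ := hF.exists_rotated_concat hq hp hr''
    by_cases hpz : G.Adj p (C.formPerm⁻¹ (C.formPerm⁻¹ p))
    · have hD := hF.shift (X := Y' ++ [z']) hq hp (by simpa using hr'') hpz
      refine ih hD (w := w) (X := w' :: X) (Y := Y' ++ [z']) ?_ hqz (by simpa using hY)
      have := rotated_pair_swap (List.IsRotated.refl
        (q :: ((Y' ++ [z']) ++ p :: w' :: (X ++ [z, w]))))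
      simpa using this
    · exact ⟨C, hF, hpz, by rwa [(formPerm_inv_eq hF.longest.1.1 hr).2]⟩

/-- Frames do not exist. -/
theorem elim {C : List V} {S : Finset V} (hF : IsFrame G C S) : False := by
  obtain ⟨p, hp, q, hq, hpq⟩ := Finset.one_lt_card.1 hF.two_le
  obtain ⟨X, Y, hr⟩ := exists_rotated_pair (hF.mem p hp) (hF.mem q hq) hpq
  obtain ⟨C, X, z, w, Y, hF, hr, hqz⟩ := exists_shifted_right hp hq _ hF hr rfl
  obtain ⟨C, hF, hpz, hqz⟩ := exists_shifted_both hp hq _ hF hr hqz rfl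
  set σ := C.formPerm with hσ
  have hinj : Function.Injective ⇑(σ⁻¹) := (σ⁻¹).injective
  set P := ((S.erase p).erase q).image ⇑(σ⁻¹) with hP
  have hPcard : P.card + 2 = S.card := by
    rw [hP, Finset.card_image_of_injective _ hinj,
      Finset.card_erase_of_mem (Finset.mem_erase.2 ⟨hpq.symm, hq⟩), Finset.card_erase_of_mem hp]
    have := hF.two_le
    omega
  have hPmem : ∀ v ∈ P, ∃ s ∈ S, s ≠ p ∧ s ≠ q ∧ σ⁻¹ s = v := by
    intro v hv
    obtain ⟨s, hs, rfl⟩ := Finset.mem_image.1 hv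
    simp only [Finset.mem_erase] at hs
    exact ⟨s, hs.2.2, hs.2.1, hs.1, rfl⟩
  have hzS : ∀ s ∈ S, ∀ t ∈ S, s ≠ t → s ≠ σ⁻¹ (σ⁻¹ t) := by
    intro s hs t ht hst heq
    have h1 : σ s = σ⁻¹ t := by rw [heq]; simp
    have h2 := hF.adj_pred_succ ht
    rw [← hσ, ← h1] at h2
    exact hF.not_adj_succ hs ht h2
  have hzz : ∀ s ∈ S, s ≠ σ⁻¹ (σ⁻¹ s) := by
    intro s hs heq
    refine hF.longest.1.formPerm_formPerm_ne (hF.mem s hs) ?_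
    rw [← hσ]
    conv_lhs => rw [heq]
    simp
  have hPS : ∀ v ∈ P, v ∉ S := by
    intro v hv
    obtain ⟨s, hs, -, -, rfl⟩ := hPmem v hv
    exact hF.formPerm_inv_notMem hs
  have hzP : ∀ t ∈ S, σ⁻¹ (σ⁻¹ t) ∉ P := by
    intro t ht hm
    obtain ⟨s, hs, -, -, he⟩ := hPmem _ hm
    exact hF.formPerm_inv_notMem ht (hinj he ▸ hs)
  have hcard : (insert p (insert q (insert (σ⁻¹ (σ⁻¹ p)) (insert (σ⁻¹ (σ⁻¹ q)) P)))).card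
      = S.card + 2 := by
    rw [Finset.card_insert_of_notMem, Finset.card_insert_of_notMem, Finset.card_insert_of_notMem,
      Finset.card_insert_of_notMem (hzP q hq)]
    · omega
    · simp only [Finset.mem_insert, not_or]
      exact ⟨fun h => hpq (hinj (hinj h)), hzP p hp⟩
    · simp only [Finset.mem_insert, not_or]
      exact ⟨hzS q hq p hp hpq.symm, hzz q hq, fun h => hPS q h hq⟩
    · simp only [Finset.mem_insert, not_or]
      exact ⟨hpq, hzz p hp, hzS p hp q hq hpq, fun h => hPS p h hp⟩
  have hsP : ∀ s, s = p ∨ s = q → s ∈ S → ∀ v ∈ P, ¬ G.Adj s v := by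
    intro s hs hsS v hv
    obtain ⟨t, ht, htp, htq, rfl⟩ := hPmem v hv
    refine hF.not_adj_pred_of_ne hsS ht ?_
    rintro rfl
    tauto
  have hzPadj : ∀ s, s = p ∨ s = q → s ∈ S → ∀ v ∈ P, ¬ G.Adj (σ⁻¹ (σ⁻¹ s)) v := by
    intro s hs hsS v hv
    obtain ⟨t, ht, htp, htq, rfl⟩ := hPmem v hv
    refine hF.not_adj_predpred_pred ht hsS ?_
    rintro rfl
    tauto
  have hPP : ∀ u ∈ P, ∀ v ∈ P, ¬ G.Adj u v := by
    intro u hu v hv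
    obtain ⟨s, hs, -, -, rfl⟩ := hPmem u hu
    obtain ⟨t, ht, -, -, rfl⟩ := hPmem v hv
    exact hF.not_adj_pred hs ht
  have i1 : G.IsIndepSet (P : Set V) := fun u hu v hv _ => hPP u hu v hv
  have i2 := hF.indep (insert p (insert q (insert (σ⁻¹ (σ⁻¹ p)) (insert (σ⁻¹ (σ⁻¹ q)) P)))) (by
    simp only [Finset.coe_insert]
    refine Set.Pairwise.insert (Set.Pairwise.insert (Set.Pairwise.insert
      (Set.Pairwise.insert i1 ?_) ?_) ?_) ?_
    · intro v hv _
      have := hzPadj q (Or.inr rfl) hq v hv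
      exact ⟨this, fun h => this h.symm⟩
    · rintro v (rfl | hv) _
      · have := hF.not_adj_predpred hq hp hpq.symm
        exact ⟨this, fun h => this h.symm⟩
      · have := hzPadj p (Or.inl rfl) hp v hv
        exact ⟨this, fun h => this h.symm⟩
    · rintro v (rfl | rfl | hv) _
      · have := hF.not_adj_predpred_of_ne hq hp hpq.symm
        exact ⟨this, fun h => this h.symm⟩
      · exact ⟨hqz, fun h => hqz h.symm⟩
      · have := hsP q (Or.inr rfl) hq v hv
        exact ⟨this, fun h => this h.symm⟩
    · rintro v (rfl | rfl | rfl | hv) _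
      · have := hF.not_adj hp hq
        exact ⟨this, fun h => this h.symm⟩
      · exact ⟨hpz, fun h => hpz h.symm⟩
      · have := hF.not_adj_predpred_of_ne hp hq hpq
        exact ⟨this, fun h => this h.symm⟩
      · have := hsP p (Or.inl rfl) hp v hv
        exact ⟨this, fun h => this h.symm⟩)
  omega

end IsFrame

end

section

variable {V : Type*} {G : SimpleGraph V}

theorem exists_maximal_of_bounded {α : Type*} (p : α → Prop) (f : α → ℕ) (B : ℕ)
    (hB : ∀ x, p x → f x ≤ B) (hp : ∃ x, p x) : ∃ x, p x ∧ ∀ y, p y → f y ≤ f x := by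
  obtain ⟨x, hx⟩ := hp
  have hbdd : BddAbove (f '' {x | p x}) := ⟨B, by rintro _ ⟨y, hy, rfl⟩; exact hB y hy⟩
  obtain ⟨y, hy, he⟩ := Nat.sSup_mem (Set.Nonempty.image f ⟨x, hx⟩) hbdd
  exact ⟨y, hy, fun z hz => he ▸ le_csSup hbdd ⟨z, hz, rfl⟩⟩

theorem isTrail_support {u v : V} (p : G.Walk u v) : IsTrail G u p.support v := by
  refine ⟨p.isChain_adj_support, ?_, ?_⟩
  · rw [List.head?_eq_some_head p.support_ne_nil, p.head_support]
  · rw [List.getLast?_eq_some_getLast p.support_ne_nil, p.getLast_support]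

theorem exists_isCyc_of_not_isAcyclic (h : ¬ G.IsAcyclic) : ∃ l, IsCyc G l := by
  simp only [SimpleGraph.IsAcyclic, not_forall, not_not] at h
  obtain ⟨v, p, hp⟩ := h
  cases p with
  | nil => exact absurd hp (by simp)
  | cons hadj q =>
    have h1 := hp.support_nodup
    have h2 := hp.three_le_length
    simp only [SimpleGraph.Walk.support_cons, List.tail_cons,
      SimpleGraph.Walk.length_cons] at h1 h2
    exact ⟨q.support, (isTrail_support q).isCyc hadj h1 (by simpa using h2)⟩

theorem isCyc_toList_of_isClique {K : Finset V} (hK : G.IsClique K) (h3 : 3 ≤ K.card) :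
    IsCyc G K.toList := by
  have hch : K.toList.IsChain G.Adj :=
    List.Pairwise.isChain ((K.nodup_toList).imp_of_mem fun ha hb hab =>
      hK (by simpa using ha) (by simpa using hb) hab)
  have hne : K.toList ≠ [] := by
    intro h; rw [Finset.toList_eq_nil] at h; simp [h] at h3
  obtain ⟨a, b, hab⟩ := IsTrail.of_isChain hch hne
  refine hab.isCyc (hK (by simpa using hab.right_mem) (by simpa using hab.left_mem) ?_)
    K.nodup_toList (by simpa using h3)
  rintro rfl
  obtain ⟨l, hl⟩ := hab.exists_cons
  have hnd := K.nodup_toList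
  have hlen : K.toList.length = K.card := K.length_toList
  rw [hl] at hab hnd hlen
  cases l with
  | nil => simp at hlen; omega
  | cons c l =>
    have h' : IsTrail G b ([b] ++ c :: l) b := hab
    obtain ⟨u, v, -, -, hv⟩ := h'.split (by simp) (by simp)
    exact (List.nodup_cons.1 hnd).1 hv.right_mem

theorem notMem_image_formPerm [DecidableEq V] {C : List V} {a : V} {T : Finset V} (hT : ∀ t ∈ T, t ∈ C) (ha : a ∉ C) :
    a ∉ T.image C.formPerm := by
  intro hm
  obtain ⟨s, hs, rfl⟩ := Finset.mem_image.1 hm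
  exact ha (List.formPerm_apply_mem_of_mem (hT s hs))

/-- A set of vertices that separates a union of components from the rest bounds the
connectivity. -/
theorem connectivity_le_card (S : Finset V) (A : Set V) {a b : V} (ha : a ∈ A) (hb : b ∉ A)
    (haS : a ∉ S) (hbS : b ∉ S) (h : ∀ x ∈ A, ∀ y, G.Adj x y → y ∈ A ∨ y ∈ S) :
    connectivity G ≤ S.card := by
  refine Nat.sInf_le ⟨S, rfl, Or.inl fun hpre => ?_⟩
  obtain ⟨p⟩ := hpre ⟨a, by simpa using haS⟩ ⟨b, by simpa using hbS⟩
  have key : ∀ u v : ((S : Set V)ᶜ : Set V), (G.induce ((S : Set V)ᶜ)).Walk u v →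
      (u : V) ∈ A → (v : V) ∈ A := by
    intro u v p
    induction p with
    | nil => exact id
    | cons hadj q ih =>
      intro hu
      refine ih ((h _ hu _ hadj).resolve_right ?_)
      rename_i w _
      exact w.2
  exact hb (key _ _ p ha)

theorem exists_separator [Fintype V] (G : SimpleGraph V) :
    ∃ S : Finset V, S.card = connectivity G ∧
      (¬ (G.induce ((S : Set V)ᶜ)).Preconnected ∨ ((S : Set V)ᶜ).Subsingleton) :=
  Nat.sInf_mem (s := {k : ℕ | ∃ S : Finset V, S.card = k ∧
    (¬ (G.induce ((S : Set V)ᶜ)).Preconnected ∨ ((S : Set V)ᶜ).Subsingleton)})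
    ⟨_, Finset.univ, rfl, Or.inr (by simp)⟩

theorem connectivity_le_degree [Fintype V] [DecidableRel G.Adj]
    (hV : connectivity G + 1 ≤ Fintype.card V) (v : V) : connectivity G ≤ G.degree v := by
  classical
  by_contra! hlt
  have : (insert v (G.neighborFinset v)).card < (Finset.univ : Finset V).card := by
    have := Finset.card_insert_le v (G.neighborFinset v)
    rw [G.card_neighborFinset_eq_degree] at this
    rw [Finset.card_univ]
    omega
  obtain ⟨b, -, hb⟩ := Finset.exists_mem_notMem_of_card_lt_card this
  simp only [Finset.mem_insert, not_or] at hb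
  have := connectivity_le_card (G := G) (G.neighborFinset v) {v} rfl hb.1 (by simp) hb.2
    (by rintro x rfl y hy; right; simpa using hy)
  rw [G.card_neighborFinset_eq_degree] at this
  omega

theorem exists_isLongestCyc [Fintype V] (hconn : G.Connected) (hk : 2 ≤ connectivity G)
    (hV : connectivity G + 1 ≤ Fintype.card V) : ∃ C, IsLongestCyc G C := by
  classical
  have hcyc : ∃ l, IsCyc G l := by
    refine exists_isCyc_of_not_isAcyclic fun hac => ?_
    have : Nontrivial V := Fintype.one_lt_card_iff_nontrivial.1 (by omega)
    have h1 := SimpleGraph.IsTree.minDegree_eq_one_of_nontrivial (G := G) ⟨hconn, hac⟩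
    obtain ⟨v, hv⟩ := G.exists_minimal_degree_vertex
    have := connectivity_le_degree hV v
    omega
  exact exists_maximal_of_bounded (IsCyc G) List.length (Fintype.card V)
    (fun l hl => hl.1.length_le_card) hcyc

/-- The graph formed by the edges of `G` that avoid `C`. -/
def offGraph (G : SimpleGraph V) (C : List V) : SimpleGraph V where
  Adj a b := G.Adj a b ∧ a ∉ C ∧ b ∉ C
  symm := ⟨fun _ _ h => ⟨h.1.symm, h.2.2, h.2.1⟩⟩
  loopless := ⟨fun _ h => h.1.ne rfl⟩

theorem offGraph_walk_notMem {C : List V} {u v : V} (p : (offGraph G C).Walk u v) (hu : u ∉ C) :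
    ∀ w ∈ p.support, w ∉ C := by
  induction p with
  | nil => simpa using hu
  | cons hadj q ih =>
    intro w hw
    rw [SimpleGraph.Walk.support_cons, List.mem_cons] at hw
    rcases hw with rfl | hw
    · exact hu
    · exact ih hadj.2.2 w hw

open Classical in
/-- The component of `h` after the deletion of `C`. -/
noncomputable def offComp [Fintype V] (G : SimpleGraph V) (C : List V) (h : V) : Finset V :=
  Finset.univ.filter ((offGraph G C).Reachable h)

open Classical in
/-- The vertices of `C` with a neighbour in the component of `h` after the deletion of `C`. -/
noncomputable def attachments [Fintype V] (G : SimpleGraph V) (C : List V) (h : V) : Finset V :=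
  Finset.univ.filter (fun v => v ∈ C ∧ ∃ a ∈ offComp G C h, G.Adj a v)

variable [Fintype V] {C : List V} {h : V}

theorem mem_offComp {v : V} : v ∈ offComp G C h ↔ (offGraph G C).Reachable h v := by
  simp [offComp]

theorem mem_attachments {v : V} :
    v ∈ attachments G C h ↔ v ∈ C ∧ ∃ a ∈ offComp G C h, G.Adj a v := by
  simp [attachments]

theorem self_mem_offComp : h ∈ offComp G C h := mem_offComp.2 (SimpleGraph.Reachable.refl _)

theorem notMem_of_mem_offComp (hh : h ∉ C) {v : V} (hv : v ∈ offComp G C h) : v ∉ C := by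
  obtain ⟨p⟩ := mem_offComp.1 hv
  exact offGraph_walk_notMem p hh v p.end_mem_support

theorem offComp_closed {v w : V} (hh : h ∉ C) (hv : v ∈ offComp G C h) (hadj : G.Adj v w)
    (hw : w ∉ C) : w ∈ offComp G C h := by
  have : (offGraph G C).Adj v w := ⟨hadj, notMem_of_mem_offComp hh hv, hw⟩
  exact mem_offComp.2 ((mem_offComp.1 hv).trans this.reachable)

theorem mem_attachments_of_adj {v w : V} (hw : w ∈ C) (hv : v ∈ offComp G C h)
    (hadj : G.Adj v w) : w ∈ attachments G C h := mem_attachments.2 ⟨hw, v, hv, hadj⟩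

theorem exists_isHandle_offComp {s t : V} (hh : h ∉ C)
    (hs : s ∈ attachments G C h) (ht : t ∈ attachments G C h) :
    ∃ L, IsHandle G C s t L ∧ ∀ v ∈ L, v ∈ offComp G C h := by
  classical
  obtain ⟨-, a, ha, has⟩ := mem_attachments.1 hs
  obtain ⟨-, b, hb, hbt⟩ := mem_attachments.1 ht
  have hab : (offGraph G C).Reachable a b := (mem_offComp.1 ha).symm.trans (mem_offComp.1 hb)
  obtain ⟨p, hp⟩ := hab.exists_isPath
  have hsub : ∀ v ∈ p.support, v ∈ offComp G C h := fun v hv =>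
    mem_offComp.2 ((mem_offComp.1 ha).trans ⟨p.takeUntil v hv⟩)
  have htr := isTrail_support p
  exact ⟨p.support, ⟨hp.support_nodup, fun v hv => notMem_of_mem_offComp hh (hsub v hv), a, b,
    ⟨htr.1.imp fun _ _ h => h.1, htr.2⟩, has.symm, hbt⟩, hsub⟩

theorem attachments_subset : ∀ t ∈ attachments G C h, t ∈ C :=
  fun _ ht => (mem_attachments.1 ht).1

variable [DecidableEq V]

theorem formPerm_notMem_attachments (hC : IsLongestCyc G C) (hh : h ∉ C) {s : V}
    (hs : s ∈ attachments G C h) : C.formPerm s ∉ attachments G C h := by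
  intro hs'
  obtain ⟨L, hL, -⟩ := exists_isHandle_offComp hh hs hs'
  have hsC := (mem_attachments.1 hs).1
  exact hC.formPerm_ne hsC (mem_attachments.1 hs').1 (hC.1.formPerm_ne_self hsC).symm hL rfl

theorem not_adj_formPerm_attachments (hC : IsLongestCyc G C) (hh : h ∉ C) {s a : V}
    (hs : s ∈ attachments G C h) (ha : a ∈ offComp G C h) : ¬ G.Adj a (C.formPerm s) := fun hadj =>
  formPerm_notMem_attachments hC hh hs (mem_attachments_of_adj
    (List.formPerm_apply_mem_of_mem (mem_attachments.1 hs).1) ha hadj)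

theorem isIndepSet_image_formPerm (hC : IsLongestCyc G C) (hh : h ∉ C) :
    G.IsIndepSet ((attachments G C h).image C.formPerm : Finset V) := by
  intro u hu v hv huv
  obtain ⟨s, hs, rfl⟩ := Finset.mem_image.1 (Finset.mem_coe.1 hu)
  obtain ⟨t, ht, rfl⟩ := Finset.mem_image.1 (Finset.mem_coe.1 hv)
  obtain ⟨L, hL, -⟩ := exists_isHandle_offComp hh hs ht
  exact hC.not_adj_formPerm (mem_attachments.1 hs).1 (mem_attachments.1 ht).1
    (fun h => huv (by rw [h])) hL

theorem card_attachments (hC : IsLongestCyc G C) (hh : h ∉ C)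
    (hα : G.indepNum ≤ connectivity G + 1) : (attachments G C h).card = connectivity G := by
  apply le_antisymm
  · have hind : G.IsIndepSet (insert h ((attachments G C h).image C.formPerm) : Finset V) := by
      rw [Finset.coe_insert]
      refine Set.Pairwise.insert (isIndepSet_image_formPerm hC hh) fun v hv _ => ?_
      obtain ⟨s, hs, rfl⟩ := Finset.mem_image.1 (Finset.mem_coe.1 hv)
      have := not_adj_formPerm_attachments hC hh hs self_mem_offComp
      exact ⟨this, fun h => this h.symm⟩
    have h1 := hind.card_le_indepNum
    rw [Finset.card_insert_of_notMem (notMem_image_formPerm attachments_subset hh),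
      Finset.card_image_of_injective _ C.formPerm.injective] at h1
    omega
  · obtain ⟨c, hc⟩ : ∃ c, c ∈ C := List.exists_mem_of_ne_nil C (by
      rintro rfl; have := hC.1.2.1; simp at this)
    obtain ⟨b, hb, hbS⟩ : ∃ b ∈ C, b ∉ attachments G C h := by
      by_cases hcS : c ∈ attachments G C h
      · exact ⟨_, List.formPerm_apply_mem_of_mem hc, formPerm_notMem_attachments hC hh hcS⟩
      · exact ⟨c, hc, hcS⟩
    refine connectivity_le_card _ (offComp G C h : Set V) (a := h) (b := b) self_mem_offComp
      (fun h' => notMem_of_mem_offComp hh h' hb) (fun h' => hh (attachments_subset _ h')) hbS ?_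
    intro x hx y hxy
    by_cases hy : y ∈ C
    · exact Or.inr (mem_attachments_of_adj hy hx hxy)
    · exact Or.inl (offComp_closed hh hx hxy hy)

/-- Two non-adjacent vertices off a longest cycle, one of them in a given component, cannot both
be non-adjacent to all successors of attachments of that component. -/
theorem exists_adj_formPerm (hC : IsLongestCyc G C) (hh : h ∉ C)
    (hα : G.indepNum ≤ connectivity G + 1) {a w : V} (ha : a ∈ offComp G C h) (hw : w ∉ C)
    (haw : a ≠ w) (hadj : ¬ G.Adj a w) : ∃ x ∈ attachments G C h, G.Adj w (C.formPerm x) := by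
  by_contra! hcon
  have hind : G.IsIndepSet
      (insert a (insert w ((attachments G C h).image C.formPerm)) : Finset V) := by
    rw [Finset.coe_insert, Finset.coe_insert]
    refine Set.Pairwise.insert (Set.Pairwise.insert (isIndepSet_image_formPerm hC hh)
      fun v hv _ => ?_) ?_
    · obtain ⟨s, hs, rfl⟩ := Finset.mem_image.1 (Finset.mem_coe.1 hv)
      exact ⟨hcon s hs, fun h => hcon s hs h.symm⟩
    · rintro v (rfl | hv) _
      · exact ⟨hadj, fun h => hadj h.symm⟩
      · obtain ⟨s, hs, rfl⟩ := Finset.mem_image.1 (Finset.mem_coe.1 hv)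
        have := not_adj_formPerm_attachments hC hh hs ha
        exact ⟨this, fun h => this h.symm⟩
  have h1 := hind.card_le_indepNum
  have haC := notMem_of_mem_offComp hh ha
  have hwi := notMem_image_formPerm (C := C) (T := attachments G C h)
    attachments_subset hw
  have hai := notMem_image_formPerm (C := C) (T := attachments G C h)
    attachments_subset haC
  rw [Finset.card_insert_of_notMem (by simpa [haw] using hai),
    Finset.card_insert_of_notMem hwi,
    Finset.card_image_of_injective _ C.formPerm.injective, card_attachments hC hh hα] at h1
  omega

/-- If deleting a longest cycle leaves a further component, another longest cycle enlarges the
component of `w`. -/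
theorem exists_larger_offComp (hC : IsLongestCyc G C) (hh : h ∉ C)
    (hα : G.indepNum ≤ connectivity G + 1) {w : V} (hw : w ∉ C) (hwh : w ∉ offComp G C h) :
    ∃ D, IsLongestCyc G D ∧ w ∉ D ∧ (offComp G C w).card < (offComp G D w).card := by
  have hdisj : ∀ v ∈ offComp G C w, v ∉ offComp G C h := fun v h1 h2 =>
    hwh (mem_offComp.2 ((mem_offComp.1 h2).trans (mem_offComp.1 h1).symm))
  have hne : h ≠ w := fun he => hwh (he ▸ self_mem_offComp)
  have hnadj : ¬ G.Adj h w := fun hadj => hwh (offComp_closed hh self_mem_offComp hadj hw)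
  obtain ⟨x, hx, hwx⟩ := exists_adj_formPerm hC hh hα self_mem_offComp hw hne hnadj
  have hxC := attachments_subset _ hx
  set σ := C.formPerm with hσ
  have hσx : σ x ∈ C := List.formPerm_apply_mem_of_mem hxC
  have hσσx : σ (σ x) ∈ C := List.formPerm_apply_mem_of_mem hσx
  have key : ∃ t ∈ attachments G C h, x ≠ t ∧ (σ (σ x) = t ∨ G.Adj (σ (σ x)) (σ t)) := by
    by_cases hσσ : σ (σ x) ∈ attachments G C h
    · exact ⟨_, hσσ, (hC.1.formPerm_formPerm_ne hxC).symm, Or.inl rfl⟩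
    by_contra! hcon
    set I := ((attachments G C h).erase x).image σ with hI
    have hIC : ∀ t ∈ (attachments G C h).erase x, t ∈ C := fun t ht =>
      attachments_subset t (Finset.mem_of_mem_erase ht)
    have hImem : ∀ v ∈ I, ∃ t ∈ attachments G C h, x ≠ t ∧ σ t = v := by
      intro v hv
      obtain ⟨t, ht, rfl⟩ := Finset.mem_image.1 hv
      rw [Finset.mem_erase] at ht
      exact ⟨t, ht.2, ht.1.symm, rfl⟩
    have i1 : G.IsIndepSet (I : Set V) := (isIndepSet_image_formPerm hC hh).mono
      (Finset.coe_subset.2 (Finset.image_subset_image (Finset.erase_subset _ _)))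
    have hind : G.IsIndepSet (insert (σ (σ x)) (insert h (insert w I)) : Finset V) := by
      simp only [Finset.coe_insert]
      refine Set.Pairwise.insert (Set.Pairwise.insert (Set.Pairwise.insert i1 ?_) ?_) ?_
      · intro v hv _
        obtain ⟨t, ht, hxt, rfl⟩ := hImem v hv
        obtain ⟨L, hL, hLh⟩ := exists_isHandle_offComp hh hx ht
        have := hC.not_adj_adj_formPerm hxC (attachments_subset _ ht) hxt hL hw
          (fun hwL => hwh (hLh w hwL)) hwx.symm
        exact ⟨this, fun h => this h.symm⟩
      · rintro v (rfl | hv) _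
        · exact ⟨hnadj, fun h => hnadj h.symm⟩
        · obtain ⟨t, ht, hxt, rfl⟩ := hImem v hv
          have := not_adj_formPerm_attachments hC hh ht self_mem_offComp
          exact ⟨this, fun h => this h.symm⟩
      · rintro v (rfl | rfl | hv) _
        · have : ¬ G.Adj v (σ (σ x)) := fun hadj =>
            hσσ (mem_attachments_of_adj hσσx self_mem_offComp hadj)
          exact ⟨fun h => this h.symm, this⟩
        · have := hC.not_adj_of_adj hσx hw hwx
          exact ⟨fun h => this h.symm, this⟩
        · obtain ⟨t, ht, hxt, rfl⟩ := hImem v hv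
          have := (hcon t ht hxt).2
          exact ⟨this, fun h => this h.symm⟩
    have h1 := hind.card_le_indepNum
    have n1 : σ (σ x) ∉ I := by
      intro hm
      obtain ⟨t, ht, -, he⟩ := hImem _ hm
      exact formPerm_notMem_attachments hC hh hx (σ.injective he ▸ ht)
    have n2 : h ∉ I := notMem_image_formPerm hIC hh
    have n3 : w ∉ I := notMem_image_formPerm hIC hw
    have n4 : σ (σ x) ≠ h := fun he => hh (he ▸ hσσx)
    have n5 : σ (σ x) ≠ w := fun he => hw (he ▸ hσσx)
    rw [Finset.card_insert_of_notMem (by simp [n1, n4, n5]),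
      Finset.card_insert_of_notMem (by simp [n2, hne]), Finset.card_insert_of_notMem n3, hI,
      Finset.card_image_of_injective _ σ.injective, Finset.card_erase_of_mem hx,
      card_attachments hC hh hα] at h1
    have := Finset.card_pos.2 ⟨x, hx⟩
    rw [card_attachments hC hh hα] at this
    omega
  obtain ⟨t, ht, hxt, hor⟩ := key
  obtain ⟨L, hL, hLh⟩ := exists_isHandle_offComp hh hx ht
  obtain ⟨D, hD, hxD, hDC⟩ := hC.exists_reroute hxC (attachments_subset _ ht) hxt hL hor
  have hnotD : ∀ v ∈ offComp G C w, v ∉ D := fun v hv hvD =>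
    (hDC v hvD).elim (notMem_of_mem_offComp hw hv) fun h' => hdisj v hv (hLh v h')
  have hwD := hnotD w self_mem_offComp
  refine ⟨D, hD, hwD, Finset.card_lt_card ⟨fun v hv => ?_, fun hsub => ?_⟩⟩
  · have hv' := (SimpleGraph.reachable_iff_reflTransGen _ _).1 (mem_offComp.1 hv)
    clear hv
    induction hv' with
    | refl => exact self_mem_offComp
    | tail hb hbc ih =>
      refine offComp_closed hwD ih hbc.1 (hnotD _ (mem_offComp.2 ?_))
      exact ((SimpleGraph.reachable_iff_reflTransGen _ _).2 hb).trans hbc.reachable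
  · exact notMem_of_mem_offComp hw
      (hsub (offComp_closed hwD self_mem_offComp hwx hxD)) hσx

theorem hasTwoFactor_of_two_le_connectivity (hconn : G.Connected)
    (hcard : 3 * connectivity G + 3 ≤ Fintype.card V)
    (hα : G.indepNum ≤ connectivity G + 1) (hk : 2 ≤ connectivity G) :
    HasTwoFactorWithAtMost G 2 := by
  classical
  by_contra hno
  have hham : ∀ C, IsCyc G C → ∃ h, h ∉ C := by
    intro C hC
    by_contra! hcov
    exact hno (hasTwoFactor_of_two_cycles hC (Or.inl rfl) (by simp) fun v => Or.inl (hcov v))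
  obtain ⟨C₀, hC₀⟩ := exists_isLongestCyc hconn hk (by omega)
  obtain ⟨h₀, hh₀⟩ := hham C₀ hC₀.1
  obtain ⟨⟨C, h⟩, ⟨hC, hh⟩, hmax⟩ := exists_maximal_of_bounded
    (fun x : List V × V => IsLongestCyc G x.1 ∧ x.2 ∉ x.1)
    (fun x => (offComp G x.1 x.2).card) (Fintype.card V) (fun x _ => Finset.card_le_univ _)
    ⟨(C₀, h₀), hC₀, hh₀⟩
  simp only at hC hh hmax
  have hall : ∀ v, v ∉ C → v ∈ offComp G C h := by
    intro v hv
    by_contra hvh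
    have : h ∉ offComp G C v := fun h' => hvh (mem_offComp.2 (mem_offComp.1 h').symm)
    obtain ⟨D, hD, hhD, hlt⟩ := exists_larger_offComp hC hv hα hh this
    exact absurd (hmax (D, h) ⟨hD, hhD⟩) (not_le.2 hlt)
  have hclique : ∀ a b, a ∉ C → b ∉ C → a ≠ b → G.Adj a b := by
    intro a b ha hb hab
    by_contra hadj
    obtain ⟨x, hx, hbx⟩ := exists_adj_formPerm hC hh hα (hall a ha) hb hab hadj
    exact not_adj_formPerm_attachments hC hh hx (hall b hb) hbx
  set K := (C.toFinset)ᶜ with hK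
  have hKmem : ∀ v, v ∈ K ↔ v ∉ C := by simp [hK]
  have hKcard : C.length + K.card = Fintype.card V := by
    rw [hK, ← List.toFinset_card_of_nodup hC.1.1, Finset.card_add_card_compl]
  rcases le_or_gt 3 K.card with h3 | h3
  · refine hno (hasTwoFactor_of_two_cycles hC.1 (Or.inr (isCyc_toList_of_isClique
      (K := K) (fun a ha b hb hab => hclique a b ?_ ?_ hab) h3)) ?_ fun v => ?_)
    · exact (hKmem a).1 ha
    · exact (hKmem b).1 hb
    · intro v hv hv'
      exact (hKmem v).1 (by simpa using hv') hv
    · rw [Finset.mem_toList, hKmem]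
      exact em _
  have hScard := card_attachments hC hh hα
  refine IsFrame.elim (G := G) (C := C) (S := attachments G C h)
    ⟨hC, attachments_subset, fun s hs t ht hst => ?_,
      ⟨h, hh, fun v hv hadj => mem_attachments_of_adj hv self_mem_offComp hadj⟩,
      fun T hT => by rw [hScard]; exact hT.card_le_indepNum.trans hα, by omega, by omega, hno⟩
  obtain ⟨hsC, a, ha, has⟩ := mem_attachments.1 hs
  obtain ⟨htC, b, hb, hbt⟩ := mem_attachments.1 ht
  have haC := notMem_of_mem_offComp hh ha
  have hbC := notMem_of_mem_offComp hh hb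
  by_cases h1 : ∀ v, v ∉ C → v = a
  · obtain rfl := h1 b hbC
    exact ⟨[b], IsHandle.singleton hbC has.symm hbt, fun v hv => by simp [h1 v hv]⟩
  push Not at h1
  obtain ⟨c, hc, hca⟩ := h1
  have hKeq : ∀ v, v ∉ C → v = a ∨ v = c := by
    intro v hv
    by_contra! hne
    have : ({v, a, c} : Finset V) ⊆ K := by
      intro u hu
      simp only [Finset.mem_insert, Finset.mem_singleton] at hu
      rw [hKmem]
      rcases hu with rfl | rfl | rfl <;> assumption
    have := Finset.card_le_card this
    rw [Finset.card_eq_three.2 ⟨v, a, c, hne.1, hne.2, hca.symm, rfl⟩] at this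
    omega
  have hdeg : ∀ u u', u ∉ C → u' ∉ C → (∀ v, v ∉ C → v = u ∨ v = u') →
      G.Adj u s ∨ G.Adj u t := by
    intro u u' hu hu' hcov
    by_contra! hcon
    have h2 := connectivity_le_degree (G := G) (by omega) u
    have hsub : G.neighborFinset u ⊆
        insert u' (((attachments G C h).erase s).erase t) := by
      intro v hv
      rw [SimpleGraph.mem_neighborFinset] at hv
      by_cases hvC : v ∈ C
      · simp only [Finset.mem_insert, Finset.mem_erase]
        exact Or.inr ⟨fun e => hcon.2 (e ▸ hv), fun e => hcon.1 (e ▸ hv),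
          mem_attachments_of_adj hvC (hall u hu) hv⟩
      · rcases hcov v hvC with rfl | rfl
        · exact absurd hv (G.irrefl)
        · simp
    have h3 := Finset.card_le_card hsub
    have h4 := Finset.card_insert_le u' (((attachments G C h).erase s).erase t)
    rw [G.card_neighborFinset_eq_degree] at h3
    rw [Finset.card_erase_of_mem (Finset.mem_erase.2 ⟨hst.symm, ht⟩),
      Finset.card_erase_of_mem hs] at h4
    omega
  have ha' := hdeg a c haC hc hKeq
  have hc' := hdeg c a hc haC fun v hv => (hKeq v hv).symm
  have hpair : ∀ u u', u ∉ C → u' ∉ C → u ≠ u' → (∀ v, v ∉ C → v = u ∨ v = u') → G.Adj u s →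
      G.Adj u' t → ∃ L, IsHandle G C s t L ∧ ∀ v, v ∉ C → v ∈ L := by
    intro u u' hu hu' huu' hcov h1 h2
    refine ⟨[u, u'], ⟨by simpa using huu', by simp [hu, hu'], u, u', ?_, h1.symm, h2⟩,
      fun v hv => by simpa using hcov v hv⟩
    exact (IsTrail.singleton u').cons (hclique u u' hu hu' huu')
  by_cases hct : G.Adj c t
  · exact hpair a c haC hc hca.symm hKeq has hct
  · have hcs := hc'.resolve_right hct
    have hat : G.Adj a t := by
      rcases hKeq b hbC with rfl | rfl
      · exact hbt
      · exact absurd hbt hct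
    exact hpair c a hc haC hca (fun v hv => (hKeq v hv).symm) hcs hat

end

section

variable {V : Type*} {G : SimpleGraph V}

theorem not_hasTwoFactor_of_pendant {p q : V} (h : ∀ v, G.Adj p v → v = q) (c : ℕ) :
    ¬ HasTwoFactorWithAtMost G c := by
  rintro ⟨F, ⟨hFG, hdeg⟩, -⟩
  have hsub : F.neighborSet p ⊆ {q} := fun v hv => h v (hFG hv)
  have := Set.ncard_le_ncard hsub (Set.finite_singleton q)
  rw [hdeg p, Set.ncard_singleton] at this
  omega

theorem not_hasTwoFactor_of_isExceptional (h : IsExceptional G) (c : ℕ) :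
    ¬ HasTwoFactorWithAtMost G c := by
  rcases h with ⟨m, -, e, -, h2⟩ | ⟨m, -, ⟨f⟩⟩
  · refine not_hasTwoFactor_of_pendant (p := e.symm (Sum.inr 1)) (q := e.symm (Sum.inr 0))
      (fun v hv => ?_) c
    have h3 : (G.map e.toEmbedding).Adj (Sum.inr 1) (e v) := by
      have := (SimpleGraph.map_adj_apply (G := G) (f := e.toEmbedding)).2 hv
      simpa using this
    have h4 := h2 h3
    simp only [graphG2, SimpleGraph.sup_adj, SimpleGraph.fromRel_adj, SimpleGraph.edge_adj] at h4
    rw [Equiv.eq_symm_apply]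
    have h5 : e v = Sum.inr 0 ∧ ¬Sum.inr 1 = e v := by simpa using h4
    exact h5.1
  · refine not_hasTwoFactor_of_pendant (p := f.symm (Sum.inr 1)) (q := f.symm (Sum.inr 0))
      (fun v hv => ?_) c
    have h3 : (graphG3 m).Adj (Sum.inr 1) (f v) := by
      have := f.map_adj_iff.2 hv
      simpa using this
    have h4 : f v = Sum.inr 0 := by
      generalize f v = w at h3
      rcases w with i | i
      · simp [graphG3, cliqueWithK2] at h3
      · fin_cases i
        · rfl
        · simp at h3
    rw [← h4]
    simp

theorem exists_equiv_apply_eq {V W : Type*} (e : V ≃ W) (a : V) (b : W) :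
    ∃ e' : V ≃ W, e' a = b ∧ ∀ c, c ≠ a → e c ≠ b → e' c = e c := by
  classical
  refine ⟨e.trans (swap (e a) b), by simp, fun c hc hb => ?_⟩
  simp only [Equiv.trans_apply]
  exact swap_apply_of_ne_of_ne (fun h => hc (e.injective h)) hb

/-- A graph made of a clique and two further vertices `p`, `q`, where `p` has no neighbour but `q`
and `q` has a neighbour in the clique, is exceptional. -/
theorem isExceptional_of_pendant [Fintype V] {p q x : V} (hV : 4 ≤ Fintype.card V)
    (hpq : G.Adj p q) (hp : ∀ v, G.Adj p v → v = q)
    (hK : ∀ u v, u ≠ p → u ≠ q → v ≠ p → v ≠ q → u ≠ v → G.Adj u v)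
    (hxp : x ≠ p) (hqx : G.Adj q x) : IsExceptional G := by
  obtain ⟨m, hm⟩ : ∃ m, Fintype.card V = m + 2 := ⟨Fintype.card V - 2, by omega⟩
  obtain ⟨m, rfl⟩ : ∃ l, m = l + 2 := ⟨m - 2, by omega⟩
  have hxq : x ≠ q := hqx.ne'
  let e₀ : V ≃ Fin (m + 2) ⊕ Fin 2 := Fintype.equivOfCardEq (by simp [hm])
  obtain ⟨e₁, h1p, -⟩ := exists_equiv_apply_eq e₀ p (Sum.inr 1)
  obtain ⟨e₂, h2q, h2⟩ := exists_equiv_apply_eq e₁ q (Sum.inr 0)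
  have h2p : e₂ p = Sum.inr 1 := by rw [h2 p hpq.ne (by simp [h1p]), h1p]
  obtain ⟨e₃, h3x, h3⟩ := exists_equiv_apply_eq e₂ x (Sum.inl 0)
  have h3p : e₃ p = Sum.inr 1 := by rw [h3 p hxp.symm (by simp [h2p]), h2p]
  have h3q : e₃ q = Sum.inr 0 := by rw [h3 q hxq.symm (by simp [h2q]), h2q]
  have hleft : ∀ (e : V ≃ Fin (m + 2) ⊕ Fin 2), e p = Sum.inr 1 → e q = Sum.inr 0 →
      ∀ i, e.symm (Sum.inl i) ≠ p ∧ e.symm (Sum.inl i) ≠ q := by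
    intro e hep heq i
    constructor
    · intro h; rw [Equiv.symm_apply_eq, hep] at h; cases h
    · intro h; rw [Equiv.symm_apply_eq, heq] at h; cases h
  by_cases hy : ∃ y, y ≠ x ∧ y ≠ p ∧ G.Adj q y
  · obtain ⟨y, hyx, hyp, hqy⟩ := hy
    obtain ⟨e, h4y, h4⟩ := exists_equiv_apply_eq e₃ y (Sum.inl 1)
    have h4p : e p = Sum.inr 1 := by rw [h4 p hyp.symm (by simp [h3p]), h3p]
    have h4q : e q = Sum.inr 0 := by rw [h4 q hqy.ne (by simp [h3q]), h3q]
    have h4x : e x = Sum.inl 0 := by rw [h4 x hyx.symm (by simp [h3x]), h3x]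
    have hl := hleft e h4p h4q
    have sp : e.symm (Sum.inr 1) = p := by rw [← h4p]; simp
    have sq : e.symm (Sum.inr 0) = q := by rw [← h4q]; simp
    have sx : e.symm (Sum.inl 0) = x := by rw [← h4x]; simp
    have sy : e.symm (Sum.inl 1) = y := by rw [← h4y]; simp
    have hmap : ∀ a b, (G.map e.toEmbedding).Adj a b ↔ G.Adj (e.symm a) (e.symm b) := by
      intro a b
      have := SimpleGraph.map_adj_apply (G := G) (f := e.toEmbedding) (a := e.symm a)
        (b := e.symm b)
      simpa using this
    refine Or.inl ⟨m + 2, by omega, e, ?_, ?_⟩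
    · have hq2 : ∀ i : Fin (m + 2), (i : ℕ) < 2 → G.Adj q (e.symm (Sum.inl i)) := by
        intro i hi
        have : i = 0 ∨ i = 1 := by
          rcases i with ⟨i, hi'⟩
          interval_cases i
          · left; rfl
          · right; rfl
        rcases this with rfl | rfl
        · rwa [sx]
        · rwa [sy]
      intro a b hab
      rw [hmap]
      rcases a with i | i <;> rcases b with j | j
      · refine hK _ _ (hl i).1 (hl i).2 (hl j).1 (hl j).2 ?_
        intro h
        rw [e.symm.injective h] at hab
        exact hab.ne rfl
      · simp [graphG1, cliqueWithK2] at hab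
        rw [hab.2, sq]
        exact (hq2 i (by omega)).symm
      · simp [graphG1, cliqueWithK2] at hab
        rw [hab.2, sq]
        exact hq2 j (by omega)
      · have hij : i ≠ j := fun h => hab.ne (by rw [h])
        fin_cases i <;> fin_cases j
        · simp at hij
        · simpa [sp, sq] using hpq.symm
        · simpa [sp, sq] using hpq
        · simp at hij
    · intro a b hab
      have hne := hab.ne
      rw [hmap] at hab
      simp only [graphG2, SimpleGraph.sup_adj, SimpleGraph.fromRel_adj, SimpleGraph.edge_adj]
      by_cases ha : a = Sum.inr 1
      · have := hp _ (by rwa [ha, sp] at hab)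
        rw [Equiv.symm_apply_eq, h4q] at this
        right
        simp [ha, this]
      · by_cases hb : b = Sum.inr 1
        · have := hp _ (by rw [hb, sp] at hab; exact hab.symm)
          rw [Equiv.symm_apply_eq, h4q] at this
          right
          simp [hb, this]
        · exact Or.inl ⟨hne, Or.inl ⟨ha, hb⟩⟩
  · push Not at hy
    have hl := hleft e₃ h3p h3q
    have sp : e₃.symm (Sum.inr 1) = p := by rw [← h3p]; simp
    have sq : e₃.symm (Sum.inr 0) = q := by rw [← h3q]; simp
    have sx : e₃.symm (Sum.inl 0) = x := by rw [← h3x]; simp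
    have hqi : ∀ i : Fin (m + 2), G.Adj q (e₃.symm (Sum.inl i)) ↔ i = 0 := by
      intro i
      constructor
      · intro h
        by_contra hi
        refine hy _ ?_ (hl i).1 h
        rw [← sx]
        simpa using hi
      · rintro rfl
        rwa [sx]
    have hpi : ∀ i : Fin (m + 2), ¬ G.Adj p (e₃.symm (Sum.inl i)) := fun i h =>
      (hl i).2 (hp _ h)
    have hadj : ∀ a b, (graphG3 (m + 2)).Adj a b ↔ G.Adj (e₃.symm a) (e₃.symm b) := by
      have hlr : ∀ (i : Fin (m + 2)) (j : Fin 2), (graphG3 (m + 2)).Adj (Sum.inl i) (Sum.inr j) ↔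
          G.Adj (e₃.symm (Sum.inl i)) (e₃.symm (Sum.inr j)) := by
        intro i j
        fin_cases j
        · have := hqi i
          simp only [Fin.zero_eta, sq]
          rw [G.adj_comm, this]
          simp [graphG3, cliqueWithK2]
        · simp only [Fin.mk_one, sp]
          rw [G.adj_comm]
          simp [graphG3, cliqueWithK2, hpi i]
      rintro (i | i) (j | j)
      · by_cases hij : i = j
        · simp [hij]
        · have : G.Adj (e₃.symm (Sum.inl i)) (e₃.symm (Sum.inl j)) :=
            hK _ _ (hl i).1 (hl i).2 (hl j).1 (hl j).2 (by simpa using hij)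
          simp [graphG3, cliqueWithK2, hij, this]
      · exact hlr i j
      · rw [SimpleGraph.adj_comm, G.adj_comm]
        exact hlr j i
      · fin_cases i <;> fin_cases j
        · simp
        · simp [sp, sq, hpq.symm, graphG3, cliqueWithK2]
        · simp [sp, sq, hpq, graphG3, cliqueWithK2]
        · simp
    refine Or.inr ⟨m + 2, by omega, ⟨⟨e₃, ?_⟩⟩⟩
    intro a b
    rw [hadj]
    simp

theorem hasTwoFactor_or_isExceptional_of_cliques [Fintype V] {A B : Finset V} {a b c : V}
    (hV : 6 ≤ Fintype.card V) (hcov : ∀ v, v = c ∨ v ∈ A ∨ v ∈ B) (hcA : c ∉ A) (hcB : c ∉ B)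
    (hdisj : Disjoint A B) (hA : G.IsClique A) (hB : G.IsClique B)
    (hAB : ∀ u ∈ A, ∀ v ∈ B, ¬ G.Adj u v) (hc : ∀ u ∈ A, G.Adj c u) (ha : a ∈ A) (hb : b ∈ B)
    (hcb : G.Adj c b) : HasTwoFactorWithAtMost G 2 ∨ IsExceptional G := by
  classical
  have hcard : Fintype.card V = A.card + B.card + 1 := by
    rw [← Finset.card_union_of_disjoint hdisj, ← Finset.card_insert_of_notMem (a := c),
      ← Finset.card_univ]
    · congr 1
      ext v
      simpa using hcov v
    · simp [hcA, hcB]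
  have htwo : ∀ K M : Finset V, G.IsClique K → G.IsClique M → 3 ≤ K.card → 3 ≤ M.card →
      Disjoint K M → (∀ v, v ∈ K ∨ v ∈ M) → HasTwoFactorWithAtMost G 2 := by
    intro K M hK hM hK3 hM3 hKM hcov
    refine hasTwoFactor_of_two_cycles (isCyc_toList_of_isClique hK hK3)
      (Or.inr (isCyc_toList_of_isClique hM hM3)) (fun v hv hv' => ?_) (by simpa using hcov)
    rw [Finset.mem_toList] at hv hv'
    exact Finset.disjoint_left.1 hKM hv hv'
  have hA1 := Finset.card_pos.2 ⟨a, ha⟩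
  have hB1 := Finset.card_pos.2 ⟨b, hb⟩
  have hneA : ∀ v ∈ A, v ≠ c := fun v hv h => hcA (h ▸ hv)
  have hneB : ∀ v ∈ B, v ≠ c := fun v hv h => hcB (h ▸ hv)
  have hneAB : ∀ u ∈ A, ∀ v ∈ B, u ≠ v := fun u hu v hv h =>
    Finset.disjoint_left.1 hdisj hu (h ▸ hv)
  by_cases hB3 : 3 ≤ B.card
  · by_cases hA2 : 2 ≤ A.card
    · left
      refine htwo (insert c A) B ?_ hB ?_ hB3 ?_ fun v => ?_
      · rw [Finset.coe_insert]
        exact hA.insert fun u hu _ => hc u hu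
      · rw [Finset.card_insert_of_notMem hcA]; omega
      · rw [Finset.disjoint_insert_left]; exact ⟨hcB, hdisj⟩
      · simpa [or_assoc] using hcov v
    · right
      obtain ⟨a', ha'⟩ := Finset.card_eq_one.1 (show A.card = 1 by omega)
      obtain rfl : a = a' := by simpa [ha'] using ha
      have hcov' : ∀ v, v ≠ a → v ≠ c → v ∈ B := by
        intro v h1 h2
        rcases hcov v with h | h | h
        · exact absurd h h2
        · rw [ha'] at h; exact absurd (Finset.mem_singleton.1 h) h1
        · exact h
      refine isExceptional_of_pendant (p := a) (q := c) (x := b) (by omega) (hc a ha).symm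
        (fun v hv => ?_) (fun u v h1 h2 h3 h4 h5 => hB (hcov' u h1 h2) (hcov' v h3 h4) h5)
        (hneAB a ha b hb).symm hcb
      by_contra hvc
      exact hAB a ha v (hcov' v hv.ne' hvc) hv
  · by_cases hB2 : B.card = 2
    · obtain ⟨b', hb', hbb'⟩ := Finset.exists_mem_ne (by omega : 1 < B.card) b
      have hBeq : ∀ v ∈ B, v = b ∨ v = b' := by
        intro v hv
        by_contra! hne
        have h1 : ({v, b, b'} : Finset V) ⊆ B := by
          intro u hu
          simp only [Finset.mem_insert, Finset.mem_singleton] at hu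
          rcases hu with rfl | rfl | rfl <;> assumption
        have := Finset.card_le_card h1
        rw [Finset.card_eq_three.2 ⟨v, b, b', hne.1, hne.2, hbb'.symm, rfl⟩] at this
        omega
      by_cases hcb' : G.Adj c b'
      · left
        refine htwo A (insert c B) hA ?_ (by omega) ?_ ?_ fun v => ?_
        · rw [Finset.coe_insert]
          refine hB.insert fun u hu _ => ?_
          rcases hBeq u hu with rfl | rfl <;> assumption
        · rw [Finset.card_insert_of_notMem hcB]; omega
        · rw [Finset.disjoint_insert_right]; exact ⟨hcA, hdisj⟩
        · have := hcov v
          simp only [Finset.mem_insert]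
          tauto
      · right
        have hcov' : ∀ v, v ≠ b' → v ≠ b → v = c ∨ v ∈ A := by
          intro v h1 h2
          rcases hcov v with h | h | h
          · exact Or.inl h
          · exact Or.inr h
          · rcases hBeq v h with h | h
            · exact absurd h h2
            · exact absurd h h1
        refine isExceptional_of_pendant (p := b') (q := b) (x := c) (by omega)
          (hB hb' hb hbb') (fun v hv => ?_) (fun u v h1 h2 h3 h4 h5 => ?_)
          (hneB b' hb').symm hcb.symm
        · by_contra hvb
          rcases hcov' v hv.ne' hvb with rfl | h
          · exact hcb' hv.symm
          · exact hAB v h b' hb' hv.symm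
        · rcases hcov' u h1 h2 with rfl | hu <;> rcases hcov' v h3 h4 with rfl | hv
          · exact absurd rfl h5
          · exact hc v hv
          · exact (hc u hu).symm
          · exact hA hu hv h5
    · right
      obtain ⟨b', hb'⟩ := Finset.card_eq_one.1 (show B.card = 1 by omega)
      obtain rfl : b = b' := by simpa [hb'] using hb
      have hcov' : ∀ v, v ≠ b → v ≠ c → v ∈ A := by
        intro v h1 h2
        rcases hcov v with h | h | h
        · exact absurd h h2
        · exact h
        · rw [hb'] at h; exact absurd (Finset.mem_singleton.1 h) h1
      refine isExceptional_of_pendant (p := b) (q := c) (x := a) (by omega) hcb.symm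
        (fun v hv => ?_) (fun u v h1 h2 h3 h4 h5 => hA (hcov' u h1 h2) (hcov' v h3 h4) h5)
        (hneAB a ha b hb) (hc a ha)
      by_contra hvc
      exact hAB v (hcov' v hv.ne' hvc) b hb hv.symm

theorem exists_adj_of_separated (hconn : G.Connected) {A B : Finset V} {a b c : V}
    (hcov : ∀ v, v = c ∨ v ∈ A ∨ v ∈ B) (hdisj : Disjoint A B)
    (hAB : ∀ u ∈ A, ∀ v ∈ B, ¬ G.Adj u v) (ha : a ∈ A) (hb : b ∈ B) : ∃ u ∈ A, G.Adj c u := by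
  by_contra! hcon
  obtain ⟨p⟩ := hconn.preconnected a b
  have key : ∀ u v, G.Walk u v → u ∈ A → v ∈ A := by
    intro u v p
    induction p with
    | nil => exact id
    | cons hadj q ih =>
      intro hu
      rename_i w _
      refine ih ?_
      rcases hcov w with rfl | h | h
      · exact absurd hadj.symm (hcon _ hu)
      · exact h
      · exact absurd hadj (hAB _ hu _ h)
  exact Finset.disjoint_left.1 hdisj (key a b p ha) hb

theorem hasTwoFactor_or_isExceptional_of_connectivity_eq_one [Fintype V] (hconn : G.Connected)
    (hV : 6 ≤ Fintype.card V) (hα : G.indepNum ≤ 2) (hk : connectivity G = 1) :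
    HasTwoFactorWithAtMost G 2 ∨ IsExceptional G := by
  classical
  obtain ⟨S, hS, hsep⟩ := exists_separator G
  rw [hk] at hS
  obtain ⟨c, rfl⟩ := Finset.card_eq_one.1 hS
  have hind : ∀ x y z, x ≠ y → x ≠ z → y ≠ z → ¬ G.Adj x y → ¬ G.Adj x z → G.Adj y z := by
    intro x y z hxy hxz hyz h1 h2
    by_contra h3
    have : G.IsIndepSet (({x, y, z} : Finset V) : Set V) := by
      simp only [Finset.coe_insert, Finset.coe_singleton]
      refine Set.Pairwise.insert (Set.Pairwise.insert (Set.pairwise_singleton _ _) ?_) ?_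
      · rintro v rfl -
        exact ⟨h3, fun h => h3 h.symm⟩
      · rintro v (rfl | rfl) -
        · exact ⟨h1, fun h => h1 h.symm⟩
        · exact ⟨h2, fun h => h2 h.symm⟩
    have := this.card_le_indepNum
    rw [Finset.card_eq_three.2 ⟨x, y, z, hxy, hxz, hyz, rfl⟩] at this
    omega
  obtain ⟨A, B, a, b, hcov, hcA, hcB, hdisj, hAB, ha, hb⟩ : ∃ (A B : Finset V) (a b : V),
      (∀ v, v = c ∨ v ∈ A ∨ v ∈ B) ∧ c ∉ A ∧ c ∉ B ∧ Disjoint A B ∧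
      (∀ u ∈ A, ∀ v ∈ B, ¬ G.Adj u v) ∧ a ∈ A ∧ b ∈ B := by
    rcases hsep with hsep | hsep
    · simp only [SimpleGraph.Preconnected, not_forall] at hsep
      obtain ⟨a, b, hab⟩ := hsep
      let H := G.induce (((({c} : Finset V) : Set V))ᶜ)
      let A : Finset V := Finset.univ.filter (fun v => ∃ hv, H.Reachable a ⟨v, hv⟩)
      have hAmem : ∀ v, v ∈ A ↔ ∃ hv, H.Reachable a ⟨v, hv⟩ := by simp [A]
      refine ⟨A, Finset.univ.filter (fun v => v ≠ c ∧ v ∉ A), a, b, fun v => ?_, ?_, by simp, ?_,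
        ?_, ?_, ?_⟩
      · simp only [Finset.mem_filter, Finset.mem_univ, true_and]
        tauto
      · rw [hAmem]
        rintro ⟨hv, -⟩
        simp at hv
      · rw [Finset.disjoint_left]
        intro v hv hv'
        simp only [Finset.mem_filter] at hv'
        exact hv'.2.2 hv
      · intro u hu v hv hadj
        simp only [Finset.mem_filter, Finset.mem_univ, true_and] at hv
        obtain ⟨hu', hr⟩ := (hAmem u).1 hu
        refine hv.2 ((hAmem v).2 ⟨by simpa using hv.1, hr.trans ?_⟩)
        exact SimpleGraph.Adj.reachable (G := H) hadj
      · exact (hAmem _).2 ⟨a.2, SimpleGraph.Reachable.refl _⟩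
      · simp only [Finset.mem_filter, Finset.mem_univ, true_and]
        refine ⟨by simpa using b.2, fun h => ?_⟩
        obtain ⟨_, hr⟩ := (hAmem _).1 h
        exact hab hr
    · exfalso
      have h1 : (({c} : Finset V)ᶜ).card ≤ 1 := by
        rw [Finset.card_le_one_iff_subsingleton]
        simpa using hsep
      rw [Finset.card_compl, Finset.card_singleton] at h1
      omega
  have hneAB : ∀ u ∈ A, ∀ v ∈ B, u ≠ v := fun u hu v hv h =>
    Finset.disjoint_left.1 hdisj hu (h ▸ hv)
  have hA : G.IsClique A := fun u hu v hv huv =>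
    hind b u v (hneAB u hu b hb).symm (hneAB v hv b hb).symm huv
      (fun h => hAB u hu b hb h.symm) (fun h => hAB v hv b hb h.symm)
  have hB : G.IsClique B := fun u hu v hv huv =>
    hind a u v (hneAB a ha u hu) (hneAB a ha v hv) huv (hAB a ha u hu) (hAB a ha v hv)
  have hcov' : ∀ v, v = c ∨ v ∈ B ∨ v ∈ A := fun v => by have := hcov v; tauto
  have hBA : ∀ u ∈ B, ∀ v ∈ A, ¬ G.Adj u v := fun u hu v hv h => hAB v hv u hu h.symm
  obtain ⟨a', ha', hca⟩ := exists_adj_of_separated hconn hcov hdisj hAB ha hb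
  obtain ⟨b', hb', hcb⟩ := exists_adj_of_separated hconn hcov' hdisj.symm hBA hb ha
  by_cases hc : ∀ u ∈ A, G.Adj c u
  · exact hasTwoFactor_or_isExceptional_of_cliques hV hcov hcA hcB hdisj hA hB hAB hc ha hb' hcb
  · push Not at hc
    obtain ⟨u, hu, hcu⟩ := hc
    refine hasTwoFactor_or_isExceptional_of_cliques hV hcov' hcB hcA hdisj.symm hB hA hBA
      (fun v hv => ?_) hb ha' hca
    exact hind u c v (fun h => hcA (h ▸ hu)) (hneAB u hu v hv) (fun h => hcB (h ▸ hv))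
      (fun h => hcu h.symm) (hAB u hu v hv)

theorem one_le_connectivity [Fintype V] (hconn : G.Connected) (hV : 2 ≤ Fintype.card V) :
    1 ≤ connectivity G := by
  by_contra! h
  obtain ⟨S, hS, hsep⟩ := exists_separator G
  obtain rfl : S = ∅ := Finset.card_eq_zero.1 (by omega)
  rcases hsep with hsep | hsep
  · refine hsep fun u v => ?_
    obtain ⟨p⟩ := hconn.preconnected u v
    exact ⟨p.induce _ (by simp)⟩
  · obtain ⟨x, y, hxy⟩ := Fintype.exists_pair_of_one_lt_card (show 1 < Fintype.card V by omega)
    exact hxy (hsep (by simp) (by simp))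

end

end ChvatalErdos

theorem theorem1p5 {V : Type*} [Fintype V] (G : SimpleGraph V)
    (hconn : G.Connected)
    (hcard : 3 * ChvatalErdos.connectivity G + 3 ≤ Fintype.card V)
    (hindep : G.indepNum ≤ ChvatalErdos.connectivity G + 1) :
    ChvatalErdos.HasTwoFactorWithAtMost G 2 ↔ ¬ ChvatalErdos.IsExceptional G := by
  classical
  refine ⟨fun h h' => ChvatalErdos.not_hasTwoFactor_of_isExceptional h' 2 h, fun h => ?_⟩
  have h1 := ChvatalErdos.one_le_connectivity hconn (by omega)
  rcases Nat.lt_or_ge 1 (ChvatalErdos.connectivity G) with h2 | h2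
  · exact ChvatalErdos.hasTwoFactor_of_two_le_connectivity hconn hcard hindep h2
  · have h3 : ChvatalErdos.connectivity G = 1 := by omega
    exact (ChvatalErdos.hasTwoFactor_or_isExceptional_of_connectivity_eq_one hconn (by omega)
      (by omega) h3).resolve_right h
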